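/- There are absolute constants $c, C > 0$ such that the following holds. Let $\mathcal X \subseteq \mathbb R^d$ be a closed convex set with $\|x-y\|^2 \le D^2$ for all $x,y\in\mathcal X$. Let $F:\mathbb R^d\to\mathbb R^d$ be $L$-Lipschitz ($L>0$) and monotone on $\mathcal X$, i.e. $\|F(x)-F(y)\|\le L\|x-y\|$ and $\langle F(x)-F(y),x-y\rangle\ge 0$ for $x,y\in\mathcal X$, and let $r:\mathbb R^d\to\mathbb R$ be convex and lower semicontinuous on $\mathcal X$. Let $x^*\in\mathcal X$ be a solution of the variational inequality $\langle F(x^*),x-x^*\rangle+r(x)-r(x^*)\ge 0$ for all $x\in\mathcal X$. Let $(Z_i)_{i\ge 0}$ be a stationary Markov chain on a Polish space $\mathsf Z$ with Markov kernel $\mathrm Q$ and invariant distribution $\pi$, uniformly geometrically ergodic with mixing time $\tau\in\{1,2,\dots\}$: for every $k\in\mathbb N$, $$\sup_{z,z'\in\mathsf Z}\tfrac12\|\mathrm Q^k(z,\cdot)-\mathrm Q^k(z',\cdot)\|_{\mathsf{TV}}\le (1/4)^{\lfloor k/\tau\rfloor}.$$ Let $F(\cdot,\cdot):\mathbb R^d\times\mathsf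 Z\to\mathbb R^d$ be a measurable stochastic oracle with $\mathbb E_{Z\sim\pi}[F(x,Z)]=F(x)$ and $\|F(x,z)-F(x)\|^2\le\sigma^2+\Delta^2\|x-x^*\|^2$ for all $x\in\mathcal X$, $z\in\mathsf Z$. Let $J_0,J_1,\dots$ be i.i.d. with $\mathbb P(J_k=j)=2^{-j}$, $j\ge1$, independent of the chain. Write $\mathrm{prox}_{\gamma r}(v)=\arg\min_{u\in\mathcal X}\{\gamma r(u)+\tfrac12\|u-v\|^2\}$. Given $x^0\in\mathcal X$, a stepsize $\gamma>0$, integers $B\ge1$ and $N\ge2$, and $M=\sqrt N$, the randomized extragradient method starts with $T^0=0$ and performs, for $k=0,\dots,N-1$, $$x^{k+1/2}=\mathrm{prox}_{\gamma r}\Bigl(x^k-\gamma B^{-1}\sum_{i=1}^{B}F(x^k,Z_{T^k+i})\Bigr),\qquad T^{k+1/2}=T^k+B,$$ $$g^k=g^k_0+\begin{cases}2^{J_k}\,(g^k_{J_k}-g^k_{J_k-1}), & 2^{J_k}\le M,\\ 0,&\text{otherwise,}\end{cases}\qquad g^k_j=2^{-j}B^{-1}\sum_{i=1}^{2^jB}F(x^{k+1/2},Z_{T^{k+1/2}+i}),$$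 $$x^{k+1}=\mathrm{prox}_{\gamma r}(x^k-\gamma g^k),\qquad T^{k+1}=T^{k+1/2}+2^{J_k}B.$$ Let $\bar x^N=\frac1N\sum_{k=0}^{N-1}x^{k+1/2}$ and $\mathrm{Gap}(x)=\sup_{y\in\mathcal X}\bigl[\langle F(y),x-y\rangle+r(x)-r(y)\bigr]$. If $\gamma\le c/L$, then $\mathrm{Gap}(\bar x^N)$ is finite and integrable, and $$\mathbb E[\mathrm{Gap}(\bar x^N)]\le C\left(\frac{D^2}{\gamma N}+\gamma\Bigl(\frac{\tau\log_2N}{B}+\frac{\tau^2}{B^2}\Bigr)(\sigma^2+\Delta^2D^2)\right).$$ -/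

import Mathlib

open MeasureTheory ProbabilityTheory
open scoped ENNReal RealInnerProductSpace

noncomputable section

namespace RandEG

/-! ### Markov noise -/

section Markov

variable {S Ω : Type*} [MeasurableSpace S] [MeasurableSpace Ω]

/-- The total variation norm `‖μ - ν‖_TV = |μ - ν|(S)` (so two mutually singular probability
measures are at distance `2`). -/
def tvNormSub (μ ν : Measure S) [IsFiniteMeasure μ] [IsFiniteMeasure ν] : ℝ≥0∞ :=
  (μ.toSignedMeasure - ν.toSignedMeasure).totalVariation Set.univ

/-- The Dobrushin coefficient `sup_{z, z'} (1/2) ‖κ(z, ·) - κ(z', ·)‖_TV` of a Markov kernel. -/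
def dobrushin (κ : Kernel S S) [IsMarkovKernel κ] : ℝ≥0∞ :=
  ⨆ z : S, ⨆ z' : S, (1 / 2) * tvNormSub (κ z) (κ z')

/-- Powers of a Markov kernel (for composition of kernels) are Markov kernels. -/
instance isMarkovKernel_pow (Q : Kernel S S) [IsMarkovKernel Q] (k : ℕ) :
    IsMarkovKernel (Q ^ k) := by
  induction k with
  | zero => rw [pow_zero]; exact inferInstanceAs (IsMarkovKernel (Kernel.id : Kernel S S))
  | succ k ih => rw [pow_succ]; exact inferInstanceAs (IsMarkovKernel ((Q ^ k) ∘ₖ Q))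

/-- Uniform geometric ergodicity with mixing time `τ ≥ 1`. -/
def HasMixingTime (Q : Kernel S S) [IsMarkovKernel Q] (τ : ℕ) : Prop :=
  1 ≤ τ ∧ ∀ k : ℕ, dobrushin (Q ^ k) ≤ (1 / 4 : ℝ≥0∞) ^ (k / τ)

/-- `Z` is, under `P`, a stationary time-homogeneous Markov chain with transition kernel `Q` and
invariant distribution `π`: the Markov property holds with respect to the natural filtration. -/
structure IsStationaryMarkovChain (P : Measure Ω) (Z : ℕ → Ω → S) (Q : Kernel S S)
    (π : Measure S) : Prop where
  measurable : ∀ n, Measurable (Z n)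
  invariant : Kernel.Invariant Q π
  initial : P.map (Z 0) = π
  markov : ∀ (n : ℕ) (A : Set S), MeasurableSet A →
    P⟦Z (n + 1) ⁻¹' A | ⨆ i ∈ Set.Iic n, MeasurableSpace.comap (Z i) inferInstance⟧
      =ᵐ[P] fun ω => (Q (Z n ω)).real A

/-- `J 0, J 1, …` are i.i.d. geometric with parameter `1/2` on `{1, 2, …}`. -/
structure IsIIDGeomHalf (P : Measure Ω) (J : ℕ → Ω → ℕ) : Prop where
  measurable : ∀ k, Measurable (J k)
  law : ∀ k j : ℕ, 1 ≤ j → P (J k ⁻¹' {j}) = (1 / 2 : ℝ≥0∞) ^ j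
  indep : iIndepFun J P

end Markov

/-! ### Variational inequality, proximal map and gap function -/

section VI

variable {E : Type*} [NormedAddCommGroup E] [InnerProductSpace ℝ E]

/-- `x` solves the variational inequality
`⟨F x, y - x⟩ + r y - r x ≥ 0` for all `y ∈ X`. -/
def IsVISolution (F : E → E) (r : E → ℝ) (X : Set E) (x : E) : Prop :=
  x ∈ X ∧ ∀ y ∈ X, 0 ≤ ⟪F x, y - x⟫ + r y - r x

/-- `p` minimizes `γ r(u) + ‖u - v‖² / 2` over `u ∈ X`. -/
def IsProx (X : Set E) (r : E → ℝ) (γ : ℝ) (v p : E) : Prop :=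
  p ∈ X ∧ IsMinOn (fun u => γ * r u + (1 / 2) * ‖u - v‖ ^ 2) X p

/-- `prox_{γ r}(v) = argmin_{u ∈ X} (γ r(u) + ‖u - v‖² / 2)`. -/
def prox (X : Set E) (r : E → ℝ) (γ : ℝ) (v : E) : E :=
  Classical.epsilon (IsProx X r γ v)

/-- The minimum defining `prox` is attained for `r` lower semicontinuous on a nonempty
compact set. -/
theorem isProx_prox {X : Set E} (hX : IsCompact X) (hne : X.Nonempty) {r : E → ℝ}
    (hr : LowerSemicontinuousOn r X) {γ : ℝ} (hγ : 0 < γ) (v : E) :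
    IsProx X r γ v (prox X r γ v) := by
  apply Classical.epsilon_spec (p := IsProx X r γ v)
  have h1 : LowerSemicontinuousOn (fun u => γ * r u) X :=
    (continuous_const_mul γ).comp_lowerSemicontinuousOn hr
      (fun a b hab => mul_le_mul_of_nonneg_left hab hγ.le)
  have h2 : LowerSemicontinuousOn (fun u => (1 / 2) * ‖u - v‖ ^ 2) X := by
    apply ContinuousOn.lowerSemicontinuousOn
    fun_prop
  obtain ⟨p, hp, hmin⟩ := (h1.add h2).exists_isMinOn hne hX
  exact ⟨p, hp, hmin⟩

/-- The values `⟨F y, x - y⟩ + r x - r y`, `y ∈ X`, whose supremum is the gap function. -/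
def gapSet (F : E → E) (r : E → ℝ) (X : Set E) (x : E) : Set ℝ :=
  (fun y => ⟪F y, x - y⟫ + r x - r y) '' X

/-- `Gap(x) = sup_{y ∈ X} [⟨F y, x - y⟩ + r x - r y]`. -/
def gap (F : E → E) (r : E → ℝ) (X : Set E) (x : E) : ℝ :=
  sSup (gapSet F r X x)

end VI

/-! ### Randomized extragradient -/

section Algorithm

variable {E S : Type*} [NormedAddCommGroup E] [InnerProductSpace ℝ E]

/-- The batch average `n⁻¹ ∑_{i=1}^n G(x, z_{T+i})`. -/
def batchMean (G : E → S → E) (z : ℕ → S) (T n : ℕ) (x : E) : E :=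
  (n : ℝ)⁻¹ • ∑ i ∈ Finset.Icc 1 n, G x (z (T + i))

/-- The randomized estimate
`g = g_0 + 2^j (g_j - g_{j-1})` if `2^j ≤ M`, and `g = g_0` otherwise, where `g_i` is the average
of `G(x, ·)` over the `2^i B` samples after time `T`. -/
def randEstimate (G : E → S → E) (z : ℕ → S) (T B : ℕ) (M : ℝ) (j : ℕ) (x : E) : E :=
  batchMean G z T (2 ^ 0 * B) x +
    if (2 : ℝ) ^ j ≤ M then
      (2 : ℝ) ^ j • (batchMean G z T (2 ^ j * B) x - batchMean G z T (2 ^ (j - 1) * B) x)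
    else 0

/-- The extrapolation step, from the point `x` and the sample counter `T`. -/
def extrapolate (G : E → S → E) (r : E → ℝ) (X : Set E) (γ : ℝ) (B : ℕ) (z : ℕ → S)
    (x : E) (T : ℕ) : E :=
  prox X r γ (x - γ • batchMean G z T B x)

/-- The pair `(x^k, T^k)` of the current iterate and sample counter, for a realization `z` of the
noise and `j` of the random batch levels; `(x^0, T^0) = (x₀, 0)`. -/
def state (G : E → S → E) (r : E → ℝ) (X : Set E) (γ : ℝ) (B : ℕ) (M : ℝ) (x₀ : E)
    (z : ℕ → S) (j : ℕ → ℕ) : ℕ → E × ℕ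
  | 0 => (x₀, 0)
  | k + 1 =>
    let x := (state G r X γ B M x₀ z j k).1
    let T := (state G r X γ B M x₀ z j k).2
    (prox X r γ
        (x - γ • randEstimate G z (T + B) B M (j k) (extrapolate G r X γ B z x T)),
      T + B + 2 ^ j k * B)

/-- The extrapolated iterate `x^{k+1/2}`. -/
def halfIterate (G : E → S → E) (r : E → ℝ) (X : Set E) (γ : ℝ) (B : ℕ) (M : ℝ) (x₀ : E)
    (z : ℕ → S) (j : ℕ → ℕ) (k : ℕ) : E :=
  extrapolate G r X γ B z (state G r X γ B M x₀ z j k).1 (state G r X γ B M x₀ z j k).2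

/-- The average `N⁻¹ ∑_{k=0}^{N-1} x^{k+1/2}` of the extrapolated iterates. -/
def averagedIterate (G : E → S → E) (r : E → ℝ) (X : Set E) (γ : ℝ) (B : ℕ) (M : ℝ) (x₀ : E)
    (z : ℕ → S) (j : ℕ → ℕ) (N : ℕ) : E :=
  (N : ℝ)⁻¹ • ∑ k ∈ Finset.range N, halfIterate G r X γ B M x₀ z j k

end Algorithm

end RandEG

end

/-! The variational inequalities of the two proximal steps in one iteration bound the gap summand at
any competitor `y` by a telescoping difference of `‖x^k - y‖²`, plus `γ²` times the squared errors
of both operator estimates, plus `γ⟪e_k, x^{k+1/2} - y⟫`, where `e_k` is the error of the randomized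
estimate (`extragradient_step_monotone_le`). The supremum over `y` sits inside the expectation, so
`y` may depend on the noise and the linear term cannot be averaged directly. A ghost sequence `u_k`
of projected steps along `e_k` removes `y`: `⟪e_k, u_k - y⟫` telescopes at the cost of `γ²‖e_k‖²/2`
(`ghost_step_le`). What remains is `⟪e_k, x^{k+1/2} - u_k⟫`, whose second factor is known before the
samples entering `e_k` are drawn. This gives a bound along every realization
(`gap_averagedIterate_le`).

For expectations, the levels `J` are independent of the chain, so they can be frozen
(`integral_eq_of_indepFun`); the sample counter is then deterministic and the Markov property
applies. Dependence at lag `h` is of order `4^{-⌊h/τ⌋}`, which sums to `O(τ)`. With `s` a uniform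
bound on the oracle noise, a batch of `n` samples therefore has mean square error `O(τ s²/n)`, and
bias `O(τ s/n)` against directions known beforehand.

In the randomized estimate the weight `2^j` cancels the probability `2^{-j}`. In the mean the levels
telescope to the largest admissible one, a batch of order `√N B` samples
(`abs_integral_inner_estErr_le`). In the second moment, weight `4^j`, probability `2^{-j}` and
variance `τ/(2^j B)` make each of the `O(log N)` levels contribute `O(τ/B)`
(`integral_norm_estErr_sq_le`). Young's inequality splits the bias `D s τ/(√N B)` into `D²/(γN)` and
`γ τ² s²/B²`. -/

noncomputable section

namespace RandEG

/-! ### Proximal steps -/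

section Prox

variable {E : Type*} [NormedAddCommGroup E] [InnerProductSpace ℝ E]

/-- The variational characterization of the proximal point. -/
theorem IsProx.inner_nonneg {X : Set E} {r : E → ℝ} {γ : ℝ} {v p : E} (hr : ConvexOn ℝ X r)
    (hγ : 0 ≤ γ) (hp : IsProx X r γ v p) {y : E} (hy : y ∈ X) :
    0 ≤ ⟪p - v, y - p⟫ + γ * (r y - r p) := by
  by_contra! hA
  set A := ⟪p - v, y - p⟫ + γ * (r y - r p) with hAdef
  have key : ∀ t : ℝ, 0 < t → t ≤ 1 → 0 ≤ A + t / 2 * ‖y - p‖ ^ 2 := by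
    intro t ht ht1
    have hu : (1 - t) • p + t • y ∈ X := hr.1 hp.1 hy (by linarith) ht.le (by ring)
    have h1 := hr.2 hp.1 hy (by linarith : 0 ≤ 1 - t) ht.le (by ring)
    have h2 := isMinOn_iff.1 hp.2 _ hu
    have h3 : (1 - t) • p + t • y - v = (p - v) + t • (y - p) := by
      rw [smul_sub, sub_smul, one_smul]; abel
    rw [h3, norm_add_sq_real, inner_smul_right, norm_smul, mul_pow, Real.norm_eq_abs, sq_abs] at h2
    simp only [smul_eq_mul] at h1
    have h4 := mul_le_mul_of_nonneg_left h1 hγ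
    have h5 : 0 ≤ t * (A + t / 2 * ‖y - p‖ ^ 2) := by rw [hAdef]; nlinarith
    exact nonneg_of_mul_nonneg_right h5 ht
  have hB : 0 ≤ ‖y - p‖ ^ 2 := by positivity
  have hpos : 0 < ‖y - p‖ ^ 2 - A := by linarith
  -- This `t` lies in `(0, 1]` and satisfies `t‖y - p‖² ≤ -A`, so the bound in `key` is at most `A /
  -- 2 < 0`, a contradiction.
  have := key (-A / (‖y - p‖ ^ 2 - A)) (div_pos (by linarith) hpos)
    ((div_le_one hpos).2 (by linarith))
  have h6 : -A / (‖y - p‖ ^ 2 - A) * ‖y - p‖ ^ 2 ≤ -A := by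
    rw [div_mul_eq_mul_div, div_le_iff₀ hpos]
    nlinarith
  linarith

/-- Each variational inequality is tested at the other prox point; in the sum the `r` terms cancel,
and Cauchy-Schwarz finishes. -/
theorem IsProx.norm_sub_le {X : Set E} {r : E → ℝ} {γ : ℝ} {v w p q : E} (hr : ConvexOn ℝ X r)
    (hγ : 0 ≤ γ) (hp : IsProx X r γ v p) (hq : IsProx X r γ w q) : ‖p - q‖ ≤ ‖v - w‖ := by
  have h1 := hp.inner_nonneg hr hγ hq.1
  have h2 := hq.inner_nonneg hr hγ hp.1
  have h3 : ⟪p - v, q - p⟫ + ⟪q - w, p - q⟫ = ⟪v - w, p - q⟫ - ‖p - q‖ ^ 2 := by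
    rw [← real_inner_self_eq_norm_sq]
    simp only [inner_sub_left, inner_sub_right]
    ring
  have h4 := real_inner_le_norm (v - w) (p - q)
  have h5 : ‖p - q‖ * ‖p - q‖ ≤ ‖v - w‖ * ‖p - q‖ := by nlinarith
  rcases (norm_nonneg (p - q)).eq_or_lt with h | h
  · rw [← h]; positivity
  · exact le_of_mul_le_mul_right h5 h

theorem continuous_prox {X : Set E} (hX : IsCompact X) (hne : X.Nonempty) {r : E → ℝ}
    (hc : ConvexOn ℝ X r) (hr : LowerSemicontinuousOn r X) {γ : ℝ} (hγ : 0 < γ) :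
    Continuous (prox X r γ) := by
  refine (LipschitzWith.of_dist_le_mul (K := 1) fun v w => ?_).continuous
  rw [dist_eq_norm, dist_eq_norm, NNReal.coe_one, one_mul]
  exact (isProx_prox hX hne hr hγ v).norm_sub_le hc hγ.le (isProx_prox hX hne hr hγ w)

/-- One extragradient step with inexact operator values `g₁` and `g₂`. -/
theorem extragradient_step_le {X : Set E} {r : E → ℝ} {γ : ℝ} {x h x' g₁ g₂ : E}
    (hr : ConvexOn ℝ X r) (hγ : 0 ≤ γ) (hh : IsProx X r γ (x - γ • g₁) h)
    (hx' : IsProx X r γ (x - γ • g₂) x') {y : E} (hy : y ∈ X) :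
    γ * (⟪g₂, h - y⟫ + r h - r y) ≤
      1 / 2 * ‖x - y‖ ^ 2 - 1 / 2 * ‖x' - y‖ ^ 2 - 1 / 2 * ‖h - x‖ ^ 2 +
        γ ^ 2 / 2 * ‖g₁ - g₂‖ ^ 2 := by
  have h1 := hx'.inner_nonneg hr hγ hy
  have h2 := hh.inner_nonneg hr hγ hx'.1
  -- Testing `h` at `x'` and `x'` at `y` cancels `r x'` and leaves the cross term `γ⟪g₁ - g₂, x' -
  -- h⟫`. This square bounds it by `‖x' - h‖²/2 + γ²‖g₁ - g₂‖²/2`, the first part being absorbed.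
  have h3 : 0 ≤ ‖(x' - h) - γ • (g₁ - g₂)‖ ^ 2 := by positivity
  have h4 : ‖γ • (g₁ - g₂)‖ ^ 2 = γ ^ 2 * ‖g₁ - g₂‖ ^ 2 := by
    rw [norm_smul, mul_pow, Real.norm_eq_abs, sq_abs]
  rw [norm_sub_sq_real, h4] at h3
  have e1 : ‖x - y‖ ^ 2 = ⟪x - y, x - y⟫ := (real_inner_self_eq_norm_sq _).symm
  have e2 : ‖x' - y‖ ^ 2 = ⟪x' - y, x' - y⟫ := (real_inner_self_eq_norm_sq _).symm
  have e3 : ‖h - x‖ ^ 2 = ⟪h - x, h - x⟫ := (real_inner_self_eq_norm_sq _).symm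
  have e4 : ‖x' - h‖ ^ 2 = ⟪x' - h, x' - h⟫ := (real_inner_self_eq_norm_sq _).symm
  rw [e4] at h3
  rw [e1, e2, e3]
  simp only [inner_sub_left, inner_sub_right, inner_smul_left, inner_smul_right,
    RCLike.conj_to_real] at h1 h2 h3 ⊢
  have c1 := real_inner_comm x y
  have c2 := real_inner_comm x' y
  have c3 := real_inner_comm x h
  have c4 := real_inner_comm x x'
  have c5 := real_inner_comm x' h
  have c6 := real_inner_comm g₁ x'
  have c7 := real_inner_comm g₁ h
  have c8 := real_inner_comm g₂ x'
  have c9 := real_inner_comm g₂ h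
  rw [c6, c7, c8, c9] at h3
  nlinarith

/-- The extragradient step for a monotone Lipschitz operator, with the error of the operator
values made explicit. -/
theorem extragradient_step_monotone_le {X : Set E} {F : E → E} {r : E → ℝ} {γ L : ℝ}
    {x h x' g₁ g₂ : E} (hr : ConvexOn ℝ X r)
    (hL : 0 < L) (hF : ∀ x ∈ X, ∀ y ∈ X, ‖F x - F y‖ ≤ L * ‖x - y‖)
    (hmono : ∀ x ∈ X, ∀ y ∈ X, 0 ≤ ⟪F x - F y, x - y⟫)
    (hγ : 0 ≤ γ) (hγL : γ ≤ 1 / 2 / L) (hx : x ∈ X)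
    (hh : IsProx X r γ (x - γ • g₁) h)
    (hx' : IsProx X r γ (x - γ • g₂) x') {y : E} (hy : y ∈ X) :
    γ * (⟪F y, h - y⟫ + r h - r y) ≤
      1 / 2 * ‖x - y‖ ^ 2 - 1 / 2 * ‖x' - y‖ ^ 2 +
        3 * γ ^ 2 / 2 * (‖g₁ - F x‖ ^ 2 + ‖g₂ - F h‖ ^ 2) - γ * ⟪g₂ - F h, h - y⟫ := by
  have h1 := extragradient_step_le hr hγ hh hx' hy
  have h2 := hmono h hh.1 y hy
  have h3 := hF x hx h hh.1
  have h4 : ‖g₁ - g₂‖ ≤ ‖g₁ - F x‖ + ‖F x - F h‖ + ‖g₂ - F h‖ := by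
    have : g₁ - g₂ = (g₁ - F x) + (F x - F h) - (g₂ - F h) := by abel
    rw [this]
    exact (norm_sub_le _ _).trans (by gcongr; exact norm_add_le _ _)
  have h5 : ‖g₁ - g₂‖ ^ 2 ≤ 3 * (‖g₁ - F x‖ ^ 2 + ‖F x - F h‖ ^ 2 + ‖g₂ - F h‖ ^ 2) := by
    have := pow_le_pow_left₀ (norm_nonneg _) h4 2
    nlinarith [sq_nonneg (‖g₁ - F x‖ - ‖F x - F h‖), sq_nonneg (‖g₁ - F x‖ - ‖g₂ - F h‖),
      sq_nonneg (‖F x - F h‖ - ‖g₂ - F h‖)]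
  -- With `γL ≤ 1/2`, the Lipschitz part of `h5` costs `3/8 ‖h - x‖²`, which the available `-1/2 ‖h
  -- - x‖²` absorbs.
  have h6 : γ * ‖F x - F h‖ ≤ 1 / 2 * ‖h - x‖ := by
    rw [norm_sub_rev x h] at h3
    calc γ * ‖F x - F h‖ ≤ γ * (L * ‖h - x‖) := by gcongr
      _ = (γ * L) * ‖h - x‖ := by ring
      _ ≤ 1 / 2 * ‖h - x‖ := by gcongr; exact (le_div_iff₀ hL).1 hγL
  have h7 : γ ^ 2 * ‖F x - F h‖ ^ 2 ≤ 1 / 4 * ‖h - x‖ ^ 2 := by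
    have := pow_le_pow_left₀ (by positivity) h6 2
    rw [mul_pow, mul_pow] at this
    linarith
  have h8 := mul_le_mul_of_nonneg_left h5 (by positivity : 0 ≤ γ ^ 2 / 2)
  have h9 := mul_nonneg hγ h2
  rw [inner_sub_left] at h9
  rw [inner_sub_left (g₂)]
  nlinarith [sq_nonneg ‖h - x‖]

/-- The standard regret bound for a projected step along an arbitrary vector `e`. It holds for every
`y` at once, hence also for a `y` chosen after the noise is seen. -/
theorem ghost_step_le {X : Set E} (hX : Convex ℝ X) {γ : ℝ} {u u' e : E}
    (hu' : IsProx X (fun _ => 0) 1 (u - γ • e) u') {y : E} (hy : y ∈ X) :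
    γ * ⟪e, u - y⟫ ≤ 1 / 2 * ‖u - y‖ ^ 2 - 1 / 2 * ‖u' - y‖ ^ 2 + γ ^ 2 / 2 * ‖e‖ ^ 2 := by
  have h1 := hu'.inner_nonneg (convexOn_const 0 hX) zero_le_one hy
  have h3 : 0 ≤ ‖(u' - u) + γ • e‖ ^ 2 := by positivity
  have h4 : ‖γ • e‖ ^ 2 = γ ^ 2 * ‖e‖ ^ 2 := by
    rw [norm_smul, mul_pow, Real.norm_eq_abs, sq_abs]
  rw [norm_add_sq_real, h4] at h3
  have e1 : ‖u - y‖ ^ 2 = ⟪u - y, u - y⟫ := (real_inner_self_eq_norm_sq _).symm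
  have e2 : ‖u' - y‖ ^ 2 = ⟪u' - y, u' - y⟫ := (real_inner_self_eq_norm_sq _).symm
  have e3 : ‖u' - u‖ ^ 2 = ⟪u' - u, u' - u⟫ := (real_inner_self_eq_norm_sq _).symm
  rw [e3] at h3
  rw [e1, e2]
  simp only [inner_sub_left, inner_sub_right, inner_smul_left, inner_smul_right,
    RCLike.conj_to_real] at h1 h3 ⊢
  have c1 := real_inner_comm u y
  have c2 := real_inner_comm u' y
  have c4 := real_inner_comm u u'
  have c6 := real_inner_comm e u'
  have c7 := real_inner_comm e u
  rw [c6, c7] at h3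
  nlinarith

end Prox

/-! ### The gap function -/

section Gap

variable {E : Type*} [NormedAddCommGroup E] [InnerProductSpace ℝ E]

/-- As a function of `y` the gap summand is upper semicontinuous, since `F` is continuous on `X` and
`-r` is upper semicontinuous there; compactness does the rest. -/
theorem bddAbove_gapSet {X : Set E} (hX : IsCompact X) {F : E → E} {r : E → ℝ} {L : ℝ}
    (hF : ∀ x ∈ X, ∀ y ∈ X, ‖F x - F y‖ ≤ L * ‖x - y‖) (hr : LowerSemicontinuousOn r X) (x : E) :
    BddAbove (gapSet F r X x) := by
  have hFc : ContinuousOn F X := by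
    refine (LipschitzOnWith.of_dist_le_mul (K := L.toNNReal) fun x hx y hy => ?_).continuousOn
    rw [dist_eq_norm, dist_eq_norm]
    refine (hF x hx y hy).trans ?_
    gcongr
    exact Real.le_coe_toNNReal L
  have hu : UpperSemicontinuousOn (fun y => ⟪F y, x - y⟫ + r x + -r y) X := by
    refine UpperSemicontinuousOn.add ?_ ?_
    · apply ContinuousOn.upperSemicontinuousOn
      fun_prop
    · exact continuous_neg.comp_lowerSemicontinuousOn_antitone hr fun a b hab => neg_le_neg hab
  simpa only [gapSet, sub_eq_add_neg] using hu.bddAbove_of_isCompact hX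

theorem gap_nonneg {X : Set E} {F : E → E} {r : E → ℝ} {x : E} (hx : x ∈ X)
    (hb : BddAbove (gapSet F r X x)) : 0 ≤ gap F r X x :=
  le_csSup hb ⟨x, hx, by simp⟩

theorem gap_le {X : Set E} (hne : X.Nonempty) {F : E → E} {r : E → ℝ} {x : E} {c : ℝ}
    (h : ∀ y ∈ X, ⟪F y, x - y⟫ + r x - r y ≤ c) : gap F r X x ≤ c := by
  refine csSup_le (hne.image _) ?_
  rintro _ ⟨y, hy, rfl⟩
  exact h y hy

/-- The gap function is lower semicontinuous on the feasible set. -/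
theorem lowerSemicontinuousOn_gap {X : Set E} {F : E → E} {r : E → ℝ} (hne : X.Nonempty)
    (hb : ∀ x, BddAbove (gapSet F r X x)) (hr : LowerSemicontinuousOn r X) :
    LowerSemicontinuousOn (gap F r X) X := by
  intro x hx c hc
  obtain ⟨_, ⟨y, hy, rfl⟩, hlt⟩ := exists_lt_of_lt_csSup (hne.image _) hc
  have h1 : LowerSemicontinuousOn (fun x => ⟪F y, x - y⟫ + r x + -r y) X := by
    refine LowerSemicontinuousOn.add (LowerSemicontinuousOn.add ?_ hr) ?_
    · apply ContinuousOn.lowerSemicontinuousOn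
      fun_prop
    · exact continuousOn_const.lowerSemicontinuousOn
  filter_upwards [h1 x hx c (by simpa [sub_eq_add_neg] using hlt)] with x' hx'
  refine hx'.trans_le (le_csSup (hb x') ⟨y, hy, by simp [sub_eq_add_neg]⟩)

/-- Semicontinuity is available only on `X`, which makes `f` Borel on the subtype; a map with values
in `X` factors through it. Used for the gap at the averaged iterate. -/
theorem measurable_comp_of_lowerSemicontinuousOn {E Ω : Type*} [TopologicalSpace E]
    [MeasurableSpace Ω] [MeasurableSpace E] [BorelSpace E] {X : Set E} {f : E → ℝ} (hf : LowerSemicontinuousOn f X)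
    {x : Ω → E} (hx : Measurable x) (hxX : ∀ ω, x ω ∈ X) : Measurable fun ω => f (x ω) := by
  have h1 : Measurable (X.domRestrict f) := (lowerSemicontinuous_restrict_iff.2 hf).measurable
  exact h1.comp (hx.subtype_mk (h := hxX))

end Gap

/-! ### Mixing -/

section Mixing

variable {S : Type*} [MeasurableSpace S]

/-- The Jordan decomposition turns `μ - ν` into a difference of two positive measures whose masses
add up to the total variation norm, and each integral is at most `c` times a mass. -/
theorem abs_integral_sub_integral_le_tvNormSub (μ ν : Measure S) [IsFiniteMeasure μ]
    [IsFiniteMeasure ν] {g : S → ℝ} (hg : Measurable g) {c : ℝ}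
    (hc : ∀ z, |g z| ≤ c) :
    |∫ z, g z ∂μ - ∫ z, g z ∂ν| ≤ c * (tvNormSub μ ν).toReal := by
  set j := (μ.toSignedMeasure - ν.toSignedMeasure).toJordanDecomposition with hj
  have hint : ∀ (ρ : Measure S) [IsFiniteMeasure ρ], Integrable g ρ := fun ρ _ =>
    Integrable.of_bound hg.aestronglyMeasurable c (ae_of_all _ hc)
  have hnorm : ∀ (ρ : Measure S) [IsFiniteMeasure ρ], |∫ z, g z ∂ρ| ≤ c * ρ.real Set.univ :=
    fun ρ _ => norm_integral_le_of_norm_le_const (f := g) (ae_of_all _ hc)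
  have hsum : μ + j.negPart = ν + j.posPart := by
    rw [← Measure.toSignedMeasure_eq_toSignedMeasure_iff, Measure.toSignedMeasure_add,
      Measure.toSignedMeasure_add]
    have h := SignedMeasure.toSignedMeasure_toJordanDecomposition
      (μ.toSignedMeasure - ν.toSignedMeasure)
    rw [← hj, JordanDecomposition.toSignedMeasure] at h
    rw [sub_eq_sub_iff_add_eq_add] at h
    rw [← h, add_comm]
  have h1 := congrArg (fun ρ : Measure S => ∫ z, g z ∂ρ) hsum
  beta_reduce at h1
  rw [integral_add_measure (hint _) (hint _), integral_add_measure (hint _) (hint _)] at h1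
  have h2 : ∫ z, g z ∂μ - ∫ z, g z ∂ν = ∫ z, g z ∂j.posPart - ∫ z, g z ∂j.negPart := by linarith
  have h3 : (tvNormSub μ ν).toReal = j.posPart.real Set.univ + j.negPart.real Set.univ := by
    rw [tvNormSub, SignedMeasure.totalVariation, ← hj, Measure.add_apply,
      ENNReal.toReal_add (measure_ne_top _ _) (measure_ne_top _ _)]
    rfl
  rw [h2, h3, mul_add]
  exact (abs_sub _ _).trans (add_le_add (hnorm _) (hnorm _))

theorem HasMixingTime.tvNormSub_le {Q : Kernel S S} [IsMarkovKernel Q] {τ : ℕ}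
    (hQ : HasMixingTime Q τ) (k : ℕ) (z z' : S) :
    (tvNormSub ((Q ^ k) z) ((Q ^ k) z')).toReal ≤ 2 * (1 / 4 : ℝ) ^ (k / τ) := by
  have h1 : (1 / 2 : ℝ≥0∞) * tvNormSub ((Q ^ k) z) ((Q ^ k) z') ≤ (1 / 4 : ℝ≥0∞) ^ (k / τ) :=
    (le_iSup₂_of_le (f := fun z z' => (1 / 2 : ℝ≥0∞) * tvNormSub ((Q ^ k) z) ((Q ^ k) z'))
      z z' le_rfl).trans (hQ.2 k)
  have h2 := ENNReal.toReal_mono (by simp) h1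
  simp only [ENNReal.toReal_mul, ENNReal.toReal_pow, ENNReal.toReal_div, ENNReal.toReal_one,
    ENNReal.toReal_ofNat] at h2
  linarith

theorem invariant_pow {Q : Kernel S S} {π : Measure S} (h : Kernel.Invariant Q π) (k : ℕ) :
    Kernel.Invariant (Q ^ k) π := by
  induction k with
  | zero =>
    rw [pow_zero, Kernel.Invariant]
    exact Measure.id_comp
  | succ k ih => rw [pow_succ]; exact ih.comp h

/-- By invariance `π` is the `π`-average of the laws `(Q ^ k) y`, so the two-point total variation
estimate can be averaged over `y`. -/
theorem HasMixingTime.abs_integral_sub_le {Q : Kernel S S} [IsMarkovKernel Q] {τ : ℕ}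
    (hQ : HasMixingTime Q τ) {π : Measure S} [IsProbabilityMeasure π]
    (hπ : Kernel.Invariant Q π) (k : ℕ) (z : S) {g : S → ℝ} (hg : Measurable g) {c : ℝ}
    (hc : ∀ z, |g z| ≤ c) :
    |∫ z', g z' ∂((Q ^ k) z) - ∫ z', g z' ∂π| ≤ 2 * (1 / 4 : ℝ) ^ (k / τ) * c := by
  have hc0 : 0 ≤ c := (abs_nonneg _).trans (hc z)
  have hint : ∀ (ρ : Measure S) [IsFiniteMeasure ρ], Integrable g ρ := fun ρ _ =>
    Integrable.of_bound hg.aestronglyMeasurable c (ae_of_all _ hc)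
  have hbind : π.bind (Q ^ k) = π := invariant_pow hπ k
  have h1 : ∫ z', g z' ∂π = ∫ y, ∫ z', g z' ∂((Q ^ k) y) ∂π := by
    conv_lhs => rw [← hbind]
    rw [Measure.comp_eq_comp_const_apply, Kernel.integral_comp, Kernel.const_apply]
    rw [← Measure.comp_eq_comp_const_apply, hbind]
    exact hint π
  have h2 : Integrable (fun y => ∫ z', g z' ∂((Q ^ k) y)) π := by
    refine Integrable.of_bound
      (hg.stronglyMeasurable.integral_kernel (κ := Q ^ k)).aestronglyMeasurable c
      (ae_of_all _ fun y => ?_)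
    simpa using norm_integral_le_of_norm_le_const (μ := (Q ^ k) y) (f := g) (ae_of_all _ hc)
  have h3 : ∫ z', g z' ∂((Q ^ k) z) - ∫ z', g z' ∂π =
      ∫ y, (∫ z', g z' ∂((Q ^ k) z) - ∫ z', g z' ∂((Q ^ k) y)) ∂π := by
    rw [integral_sub (integrable_const _) h2, h1]
    simp
  rw [h3]
  have h4 := norm_integral_le_of_norm_le_const (μ := π)
    (f := fun y => ∫ z', g z' ∂((Q ^ k) z) - ∫ z', g z' ∂((Q ^ k) y))
    (C := 2 * (1 / 4 : ℝ) ^ (k / τ) * c) (ae_of_all _ fun y => ?_)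
  · simpa using h4
  · refine (abs_integral_sub_integral_le_tvNormSub _ _ hg hc).trans ?_
    rw [mul_comm]
    gcongr
    exact hQ.tvNormSub_le k z y

/-- An injective family of lags takes each value at most once, and `τ` consecutive lags share the
same quotient; the sum is at most `τ` times the geometric series with value `4/3`. -/
theorem sum_mixing_le {τ : ℕ} (hτ : 1 ≤ τ) {ι : Type*} (s : Finset ι) {f : ι → ℕ}
    (hf : Set.InjOn f s) : ∑ i ∈ s, (1 / 4 : ℝ) ^ (f i / τ) ≤ 4 / 3 * τ := by
  classical
  have h1 : ∀ m : ℕ, ∑ h ∈ Finset.range (τ * m), (1 / 4 : ℝ) ^ (h / τ) =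
      τ * ∑ q ∈ Finset.range m, (1 / 4 : ℝ) ^ q := by
    intro m
    induction m with
    | zero => simp
    | succ m ih =>
      rw [Nat.mul_succ, Finset.sum_range_add, ih, Finset.sum_range_succ, mul_add]
      congr 1
      rw [Finset.sum_congr rfl (g := fun _ => (1 / 4 : ℝ) ^ m)]
      · simp
      · intro x hx
        rw [Nat.mul_add_div (by omega), Nat.div_eq_of_lt (Finset.mem_range.1 hx), add_zero]
  rw [← Finset.sum_image (f := fun h => (1 / 4 : ℝ) ^ (h / τ)) hf]
  obtain ⟨m, hm⟩ := (s.image f).exists_nat_subset_range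
  calc _ ≤ ∑ h ∈ Finset.range (τ * m), (1 / 4 : ℝ) ^ (h / τ) := by
        refine Finset.sum_le_sum_of_subset_of_nonneg (hm.trans ?_) fun _ _ _ => by positivity
        exact Finset.range_subset_range.2 (Nat.le_mul_of_pos_left m hτ)
    _ = τ * ∑ q ∈ Finset.range m, (1 / 4 : ℝ) ^ q := h1 m
    _ ≤ τ * (4 / 3) := by
        gcongr
        have h2 := geom_sum_eq (by norm_num : (1 / 4 : ℝ) ≠ 1) m
        rw [h2]
        have : (0 : ℝ) ≤ (1 / 4 : ℝ) ^ m := by positivity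
        rw [div_le_iff_of_neg (by norm_num)]
        linarith
    _ = 4 / 3 * τ := by ring

end Mixing

/-! ### The Markov property -/

section MarkovProperty

variable {S Ω : Type*} [MeasurableSpace S]

/-- The natural filtration of the process `Z`. -/
abbrev past (Z : ℕ → Ω → S) (n : ℕ) : MeasurableSpace Ω :=
  ⨆ i ∈ Set.Iic n, MeasurableSpace.comap (Z i) inferInstance

theorem measurable_past {Z : ℕ → Ω → S} {i n : ℕ} (h : i ≤ n) : Measurable[past Z n] (Z i) :=
  measurable_iff_comap_le.2 (le_iSup₂_of_le (f := fun i (_ : i ∈ Set.Iic n) =>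
    MeasurableSpace.comap (Z i) inferInstance) i h le_rfl)

theorem past_mono (Z : ℕ → Ω → S) {m n : ℕ} (h : m ≤ n) : past Z m ≤ past Z n :=
  iSup₂_le fun _ hi => measurable_iff_comap_le.1 (measurable_past (le_trans hi h))

variable [MeasurableSpace Ω]

theorem past_le {Z : ℕ → Ω → S} (hZ : ∀ n, Measurable (Z n)) (n : ℕ) :
    past Z n ≤ (inferInstance : MeasurableSpace Ω) :=
  iSup₂_le fun i _ => measurable_iff_comap_le.1 (hZ i)

variable {P : Measure Ω} [IsProbabilityMeasure P] {Z : ℕ → Ω → S} {Q : Kernel S S}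
  [IsMarkovKernel Q] {π : Measure S} {α : Type*} [MeasurableSpace α]

/-- The Markov hypothesis concerns single events. Integrated over events of the past it determines
the joint law of `((Y, Z n), Z (n + 1))` on rectangles, hence everywhere. -/
theorem IsStationaryMarkovChain.lintegral_succ (hZ : IsStationaryMarkovChain P Z Q π) (n : ℕ)
    {Y : Ω → α} (hY : Measurable[past Z n] Y) {f : α × S → ℝ≥0∞} (hf : Measurable f) :
    ∫⁻ ω, f (Y ω, Z (n + 1) ω) ∂P = ∫⁻ ω, ∫⁻ z, f (Y ω, z) ∂(Q (Z n ω)) ∂P := by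
  have hle := past_le hZ.measurable n
  have hYm : Measurable Y := hY.mono hle le_rfl
  have hZm := hZ.measurable
  have hW : Measurable fun ω => (Y ω, Z n ω) := hYm.prodMk (hZm n)
  have hW' : Measurable[past Z n] fun ω => (Y ω, Z n ω) := hY.prodMk (measurable_past le_rfl)
  have key : P.map (fun ω => ((Y ω, Z n ω), Z (n + 1) ω)) =
      (P.map fun ω => (Y ω, Z n ω)) ⊗ₘ Kernel.prodMkLeft α Q := by
    have hm : Measurable fun ω => ((Y ω, Z n ω), Z (n + 1) ω) := hW.prodMk (hZm _)
    have : IsProbabilityMeasure (P.map fun ω => ((Y ω, Z n ω), Z (n + 1) ω)) :=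
      Measure.isProbabilityMeasure_map hm.aemeasurable
    refine Measure.ext_prod fun {s} {t} hs ht => ?_
    rw [Measure.map_apply hm (hs.prod ht), Measure.compProd_apply_prod hs ht,
      setLIntegral_map hs (Kernel.measurable_coe _ ht) hW]
    simp only [Kernel.prodMkLeft_apply]
    set A := (fun ω => (Y ω, Z n ω)) ⁻¹' s with hA
    have hAm : MeasurableSet[past Z n] A := hW' hs
    have hZt : MeasurableSet (Z (n + 1) ⁻¹' t) := hZm _ ht
    have h1 := setIntegral_condExp (μ := P) hle (f := (Z (n + 1) ⁻¹' t).indicator fun _ => (1 : ℝ))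
      ((integrable_const _).indicator hZt) hAm
    have h2 : ∫ ω in A, (P[(Z (n + 1) ⁻¹' t).indicator fun _ => (1 : ℝ)|past Z n]) ω ∂P =
        ∫ ω in A, (Q (Z n ω)).real t ∂P :=
      integral_congr_ae (ae_restrict_of_ae (hZ.markov n t ht))
    rw [h2, setIntegral_indicator hZt, setIntegral_const, smul_eq_mul, mul_one] at h1
    have h3 : (fun ω => ((Y ω, Z n ω), Z (n + 1) ω)) ⁻¹' s ×ˢ t = A ∩ Z (n + 1) ⁻¹' t := rfl
    have hmq : Measurable fun ω => Q (Z n ω) t := (Kernel.measurable_coe Q ht).comp (hZm n)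
    have h4 : ∫ ω in A, (Q (Z n ω)).real t ∂P = (∫⁻ ω in A, Q (Z n ω) t ∂P).toReal :=
      integral_toReal hmq.aemeasurable (ae_of_all _ fun ω => measure_lt_top (Q (Z n ω)) _)
    rw [h3, ← ENNReal.toReal_eq_toReal_iff' (measure_ne_top P _), ← h4, h1]
    · rfl
    · refine ne_top_of_le_ne_top (measure_ne_top P A) ?_
      calc ∫⁻ ω in A, Q (Z n ω) t ∂P ≤ ∫⁻ ω in A, 1 ∂P := lintegral_mono fun ω => prob_le_one
        _ = P A := by simp
  have h := congrArg (fun ρ => ∫⁻ p, f (p.1.1, p.2) ∂ρ) key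
  have hf' : Measurable fun p : (α × S) × S => f (p.1.1, p.2) := by fun_prop
  rw [lintegral_map hf' (hW.prodMk (hZm _)), Measure.lintegral_compProd hf',
    lintegral_map hf'.lintegral_kernel_prod_right' hW] at h
  exact h

/-- The `h`-step Markov property. -/
theorem IsStationaryMarkovChain.lintegral_add (hZ : IsStationaryMarkovChain P Z Q π) (n h : ℕ)
    {Y : Ω → α} (hY : Measurable[past Z n] Y) {f : α × S → ℝ≥0∞} (hf : Measurable f) :
    ∫⁻ ω, f (Y ω, Z (n + h) ω) ∂P = ∫⁻ ω, ∫⁻ z, f (Y ω, z) ∂((Q ^ h) (Z n ω)) ∂P := by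
  induction h generalizing f with
  | zero =>
    refine lintegral_congr fun ω => ?_
    rw [pow_zero]
    exact (lintegral_dirac' (f := fun z => f (Y ω, z)) _ (by fun_prop)).symm
  | succ h ih =>
    rw [← add_assoc, hZ.lintegral_succ (n + h) (hY.mono (past_mono Z (by omega)) le_rfl) hf]
    have hf1 : Measurable fun p : α × S => ∫⁻ z, f (p.1, z) ∂(Q p.2) := by
      have hf' : Measurable fun p : (α × S) × S => f (p.1.1, p.2) := by fun_prop
      exact hf'.lintegral_kernel_prod_right' (κ := Kernel.prodMkLeft α Q)
    rw [ih hf1]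
    refine lintegral_congr fun ω => ?_
    rw [pow_succ']
    exact (Kernel.lintegral_comp Q (Q ^ h) (Z n ω) (g := fun z => f (Y ω, z)) (by fun_prop)).symm

/-- A centered function of the past and a later state of the chain has small mean. -/
theorem IsStationaryMarkovChain.abs_integral_le (hZ : IsStationaryMarkovChain P Z Q π)
    [IsProbabilityMeasure π] {τ : ℕ} (hQ : HasMixingTime Q τ) (n h : ℕ)
    {Y : Ω → α} (hY : Measurable[past Z n] Y) {f : α × S → ℝ} (hf : Measurable f) {c : ℝ}
    (hc : ∀ ω z, |f (Y ω, z)| ≤ c) (h0 : ∀ ω, ∫ z, f (Y ω, z) ∂π = 0) :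
    |∫ ω, f (Y ω, Z (n + h) ω) ∂P| ≤ 2 * (1 / 4 : ℝ) ^ (h / τ) * c := by
  have hle := past_le hZ.measurable n
  have hYm : Measurable Y := hY.mono hle le_rfl
  have hZm := hZ.measurable
  have hW : Measurable fun ω => (Y ω, Z n ω) := hYm.prodMk (hZm n)
  have hm : Measurable fun ω => ((Y ω, Z n ω), Z (n + h) ω) := hW.prodMk (hZm _)
  have hW' : Measurable[past Z n] fun ω => (Y ω, Z n ω) := hY.prodMk (measurable_past le_rfl)
  have key : P.map (fun ω => ((Y ω, Z n ω), Z (n + h) ω)) =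
      (P.map fun ω => (Y ω, Z n ω)) ⊗ₘ Kernel.prodMkLeft α (Q ^ h) := by
    refine Measure.ext_of_lintegral _ fun g hg => ?_
    rw [lintegral_map hg hm, Measure.lintegral_compProd hg,
      lintegral_map hg.lintegral_kernel_prod_right' hW, hZ.lintegral_add n h hW' hg]
    rfl
  have hf' : Measurable fun p : (α × S) × S => f (p.1.1, p.2) := by fun_prop
  have hint : Integrable (fun p : (α × S) × S => f (p.1.1, p.2))
      (P.map (fun ω => ((Y ω, Z n ω), Z (n + h) ω))) := by
    rw [integrable_map_measure hf'.aestronglyMeasurable hm.aemeasurable]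
    exact Integrable.of_bound (hf'.comp hm).aestronglyMeasurable c
      (ae_of_all _ fun ω => hc ω (Z (n + h) ω))
  have h1 : ∫ ω, f (Y ω, Z (n + h) ω) ∂P = ∫ ω, ∫ z, f (Y ω, z) ∂((Q ^ h) (Z n ω)) ∂P := by
    have h2 : ∫ ω, f (Y ω, Z (n + h) ω) ∂P =
        ∫ p, f (p.1.1, p.2) ∂(P.map (fun ω => ((Y ω, Z n ω), Z (n + h) ω))) :=
      (integral_map hm.aemeasurable hf'.aestronglyMeasurable).symm
    rw [h2, key, Measure.integral_compProd (key ▸ hint), integral_map hW.aemeasurable]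
    · rfl
    · exact (hf'.stronglyMeasurable.integral_kernel_prod_right').aestronglyMeasurable
  rw [h1]
  have h4 := norm_integral_le_of_norm_le_const (μ := P)
    (f := fun ω => ∫ z, f (Y ω, z) ∂((Q ^ h) (Z n ω)))
    (C := 2 * (1 / 4 : ℝ) ^ (h / τ) * c) (ae_of_all _ fun ω => ?_)
  · simpa using h4
  · have h5 := hQ.abs_integral_sub_le hZ.invariant h (Z n ω) (g := fun z => f (Y ω, z))
      (by fun_prop) (hc ω)
    rwa [h0 ω, sub_zero] at h5

end MarkovProperty

/-! ### Batch averages along the chain -/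

theorem batchMean_sub {E S : Type*} [NormedAddCommGroup E] [InnerProductSpace ℝ E]
    {G : E → S → E} {z : ℕ → S} {T n : ℕ} (hn : 1 ≤ n) (x m : E) :
    batchMean G z T n x - m = (n : ℝ)⁻¹ • ∑ i ∈ Finset.Icc 1 n, (G x (z (T + i)) - m) := by
  have hn' : (n : ℝ) ≠ 0 := by positivity
  rw [Finset.sum_sub_distrib, smul_sub, batchMean, Finset.sum_const, Nat.card_Icc,
    Nat.add_sub_cancel, ← Nat.cast_smul_eq_nsmul ℝ, inv_smul_smul₀ hn']

section Batch

variable {E S Ω : Type*} [NormedAddCommGroup E] [InnerProductSpace ℝ E] [FiniteDimensional ℝ E]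
  [MeasurableSpace E] [BorelSpace E] [MeasurableSpace S] [MeasurableSpace Ω]

/-- The stationary mean of the oracle. -/
def meanOp (G : E → S → E) (π : Measure S) (x : E) : E :=
  ∫ z, G x z ∂π

theorem measurable_meanOp {G : E → S → E} (hG : Measurable (Function.uncurry G)) (π : Measure S)
    [SFinite π] : Measurable (meanOp G π) :=
  (hG.stronglyMeasurable.integral_prod_right).measurable

theorem integral_sub_meanOp {G : E → S → E} (hG : Measurable (Function.uncurry G)) {π : Measure S}
    [IsProbabilityMeasure π] {s : ℝ} {x : E} (hs : ∀ z, ‖G x z - meanOp G π x‖ ≤ s) :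
    Integrable (fun z => G x z - meanOp G π x) π ∧ ∫ z, (G x z - meanOp G π x) ∂π = 0 := by
  have hm : Measurable (G x) := hG.of_uncurry_left
  have h1 : Integrable (fun z => G x z - meanOp G π x) π :=
    Integrable.of_bound (hm.sub_const _).aestronglyMeasurable s (ae_of_all _ hs)
  have h2 : Integrable (G x) π :=
    (h1.add (integrable_const (meanOp G π x))).congr (ae_of_all _ fun z => by simp)
  refine ⟨h1, ?_⟩
  rw [integral_sub h2 (integrable_const _)]
  simp [meanOp]

variable {P : Measure Ω} [IsProbabilityMeasure P] {Z : ℕ → Ω → S} {Q : Kernel S S}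
  [IsMarkovKernel Q] {π : Measure S} [IsProbabilityMeasure π] {τ : ℕ} {G : E → S → E} {X : Set E}
  {s : ℝ}

/-- With `(x, w)` frozen, the noise has mean zero under `π` by the definition of `meanOp`, so only
the distance of the `h`-step law from `π` is left. -/
theorem IsStationaryMarkovChain.abs_integral_inner_le (hZ : IsStationaryMarkovChain P Z Q π)
    (hQ : HasMixingTime Q τ) (hG : Measurable (Function.uncurry G))
    (hs : ∀ x ∈ X, ∀ z, ‖G x z - meanOp G π x‖ ≤ s) (n h : ℕ) {x w : Ω → E} {b : ℝ}
    (hx : Measurable[past Z n] x) (hw : Measurable[past Z n] w) (hxX : ∀ ω, x ω ∈ X)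
    (hb : ∀ ω, ‖w ω‖ ≤ b) :
    |∫ ω, ⟪w ω, G (x ω) (Z (n + h) ω) - meanOp G π (x ω)⟫ ∂P| ≤
      2 * (1 / 4 : ℝ) ^ (h / τ) * (b * s) := by
  have hm := measurable_meanOp hG π
  have hG' : Measurable fun p : (E × E) × S => G p.1.1 p.2 :=
    hG.comp (measurable_fst.fst.prodMk measurable_snd)
  refine hZ.abs_integral_le hQ n h (Y := fun ω => (x ω, w ω))
    (f := fun p => ⟪p.1.2, G p.1.1 p.2 - meanOp G π p.1.1⟫) (hx.prodMk hw) ?_ ?_ ?_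
  · exact measurable_fst.snd.inner (hG'.sub (hm.comp measurable_fst.fst))
  · intro ω z
    refine (abs_real_inner_le_norm _ _).trans ?_
    have := hs (x ω) (hxX ω) z
    have := hb ω
    have : 0 ≤ b := (norm_nonneg _).trans this
    gcongr
  · intro ω
    obtain ⟨h1, h2⟩ := integral_sub_meanOp hG (hs (x ω) (hxX ω))
    rw [integral_inner h1, h2, inner_zero_right]

/-- The mean square of a sum of `n` centered oracle values is of order `n`. -/
theorem IsStationaryMarkovChain.integral_norm_sum_sq_le (hZ : IsStationaryMarkovChain P Z Q π)
    (hQ : HasMixingTime Q τ) (hG : Measurable (Function.uncurry G))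
    (hs : ∀ x ∈ X, ∀ z, ‖G x z - meanOp G π x‖ ≤ s) (T n : ℕ) {x : Ω → E}
    (hx : Measurable[past Z T] x) (hxX : ∀ ω, x ω ∈ X) :
    ∫ ω, ‖∑ i ∈ Finset.Icc 1 n, (G (x ω) (Z (T + i) ω) - meanOp G π (x ω))‖ ^ 2 ∂P ≤
      6 * τ * n * s ^ 2 := by
  set H : ℕ → Ω → E := fun i ω => G (x ω) (Z (T + i) ω) - meanOp G π (x ω) with hH
  have hm := measurable_meanOp hG π
  have hHm : ∀ i, Measurable[past Z (T + i)] (H i) := fun i => by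
    have hx' : Measurable[past Z (T + i)] x := hx.mono (past_mono Z (by omega)) le_rfl
    exact (hG.comp (hx'.prodMk (measurable_past le_rfl))).sub (hm.comp hx')
  have hHm' : ∀ i, Measurable (H i) := fun i => (hHm i).mono (past_le hZ.measurable _) le_rfl
  have hHs : ∀ i ω, ‖H i ω‖ ≤ s := fun i ω => hs _ (hxX ω) _
  have hint : ∀ i j, Integrable (fun ω => ⟪H i ω, H j ω⟫) P := fun i j => by
    refine Integrable.of_bound ((hHm' i).inner (hHm' j)).aestronglyMeasurable (s * s)
      (ae_of_all _ fun ω => (norm_inner_le_norm _ _).trans ?_)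
    exact mul_le_mul (hHs i ω) (hHs j ω) (norm_nonneg _) ((norm_nonneg _).trans (hHs i ω))
  have hle : ∀ i j, i ≤ j → ∫ ω, ⟪H i ω, H j ω⟫ ∂P ≤ 2 * (1 / 4 : ℝ) ^ ((j - i) / τ) * (s * s) := by
    intro i j hij
    have h1 := hZ.abs_integral_inner_le hQ hG hs (T + i) (j - i)
      (hx.mono (past_mono Z (by omega)) le_rfl) (hHm i) hxX (hHs i)
    rw [show T + i + (j - i) = T + j by omega] at h1
    exact (le_abs_self _).trans h1
  have hle' : ∀ i j, ∫ ω, ⟪H i ω, H j ω⟫ ∂P ≤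
      2 * (1 / 4 : ℝ) ^ ((if j ≤ i then i - j else j - i) / τ) * (s * s) := by
    intro i j
    split_ifs with h
    · simp_rw [real_inner_comm (H j _) (H i _)]
      exact hle j i h
    · exact hle i j (by omega)
  -- The lag `|j - i|` is injective on each side of the diagonal, giving twice `4/3 * τ`. The factor
  -- `2` in `hle'` then makes `16/3`, rounded up to `6`.
  have hrow : ∀ i, ∑ j ∈ Finset.Icc 1 n,
      (1 / 4 : ℝ) ^ ((if j ≤ i then i - j else j - i) / τ) ≤ 8 / 3 * τ := by
    intro i
    rw [← Finset.sum_filter_add_sum_filter_not _ (fun j => j ≤ i)]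
    have h1 := sum_mixing_le hQ.1 ((Finset.Icc 1 n).filter (fun j => j ≤ i))
      (f := fun j => if j ≤ i then i - j else j - i) (fun a ha b hb hab => by
        simp only [Finset.coe_filter, Set.mem_ofPred_eq] at ha hb
        simp only [ha.2, hb.2, if_true] at hab
        omega)
    have h2 := sum_mixing_le hQ.1 ((Finset.Icc 1 n).filter (fun j => ¬ j ≤ i))
      (f := fun j => if j ≤ i then i - j else j - i) (fun a ha b hb hab => by
        simp only [Finset.coe_filter, Set.mem_ofPred_eq] at ha hb
        simp only [ha.2, hb.2, if_false] at hab
        omega)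
    linarith
  calc ∫ ω, ‖∑ i ∈ Finset.Icc 1 n, H i ω‖ ^ 2 ∂P
      = ∫ ω, ∑ i ∈ Finset.Icc 1 n, ∑ j ∈ Finset.Icc 1 n, ⟪H i ω, H j ω⟫ ∂P := by
        refine integral_congr_ae (ae_of_all _ fun ω => ?_)
        beta_reduce
        rw [← real_inner_self_eq_norm_sq, sum_inner]
        simp_rw [inner_sum]
    _ = ∑ i ∈ Finset.Icc 1 n, ∑ j ∈ Finset.Icc 1 n, ∫ ω, ⟪H i ω, H j ω⟫ ∂P := by
        rw [integral_finsetSum _ fun i _ => integrable_finsetSum _ fun j _ => hint i j]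
        exact Finset.sum_congr rfl fun i _ => integral_finsetSum _ fun j _ => hint i j
    _ ≤ ∑ i ∈ Finset.Icc 1 n, ∑ j ∈ Finset.Icc 1 n,
          2 * (1 / 4 : ℝ) ^ ((if j ≤ i then i - j else j - i) / τ) * (s * s) :=
        Finset.sum_le_sum fun i _ => Finset.sum_le_sum fun j _ => hle' i j
    _ ≤ ∑ i ∈ Finset.Icc 1 n, 2 * (8 / 3 * τ) * (s * s) := by
        refine Finset.sum_le_sum fun i _ => ?_
        rw [← Finset.sum_mul, ← Finset.mul_sum]
        have := hrow i
        have := mul_self_nonneg s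
        gcongr
    _ ≤ 6 * τ * n * s ^ 2 := by
        rw [Finset.sum_const, Nat.card_Icc, nsmul_eq_mul, Nat.add_sub_cancel]
        have : (0 : ℝ) ≤ τ * n * s ^ 2 := by positivity
        nlinarith

/-- The mean square error of a batch average. -/
theorem IsStationaryMarkovChain.integral_norm_batchMean_sub_sq_le
    (hZ : IsStationaryMarkovChain P Z Q π)
    (hQ : HasMixingTime Q τ) (hG : Measurable (Function.uncurry G))
    (hs : ∀ x ∈ X, ∀ z, ‖G x z - meanOp G π x‖ ≤ s) (T : ℕ) {n : ℕ} (hn : 1 ≤ n) {x : Ω → E}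
    (hx : Measurable[past Z T] x) (hxX : ∀ ω, x ω ∈ X) :
    ∫ ω, ‖batchMean G (fun i => Z i ω) T n (x ω) - meanOp G π (x ω)‖ ^ 2 ∂P ≤
      6 * τ / n * s ^ 2 := by
  simp_rw [batchMean_sub hn, norm_smul, mul_pow]
  rw [integral_const_mul]
  have h := hZ.integral_norm_sum_sq_le hQ hG hs T n hx hxX
  have hn' : (0 : ℝ) < n := by positivity
  calc _ ≤ ‖(n : ℝ)⁻¹‖ ^ 2 * (6 * τ * n * s ^ 2) := by gcongr
    _ = 6 * τ / n * s ^ 2 := by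
        rw [norm_inv, Real.norm_of_nonneg hn'.le]
        field_simp

/-- The bias of a batch average. -/
theorem IsStationaryMarkovChain.abs_integral_inner_batchMean_sub_le
    (hZ : IsStationaryMarkovChain P Z Q π)
    (hQ : HasMixingTime Q τ) (hG : Measurable (Function.uncurry G))
    (hs : ∀ x ∈ X, ∀ z, ‖G x z - meanOp G π x‖ ≤ s) (T : ℕ) {n : ℕ} (hn : 1 ≤ n) {x w : Ω → E}
    {b : ℝ} (hx : Measurable[past Z T] x) (hw : Measurable[past Z T] w) (hxX : ∀ ω, x ω ∈ X)
    (hb : ∀ ω, ‖w ω‖ ≤ b) :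
    |∫ ω, ⟪w ω, batchMean G (fun i => Z i ω) T n (x ω) - meanOp G π (x ω)⟫ ∂P| ≤
      3 * τ / n * (b * s) := by
  have hm := measurable_meanOp hG π
  have hx' : Measurable x := hx.mono (past_le hZ.measurable _) le_rfl
  have hw' : Measurable w := hw.mono (past_le hZ.measurable _) le_rfl
  have hbs : 0 ≤ b * s := by
    obtain ⟨ω⟩ : Nonempty Ω := nonempty_of_isProbabilityMeasure P
    exact mul_nonneg ((norm_nonneg _).trans (hb ω)) ((norm_nonneg _).trans (hs _ (hxX ω) (Z 0 ω)))
  have hint : ∀ i, Integrable (fun ω => ⟪w ω, G (x ω) (Z (T + i) ω) - meanOp G π (x ω)⟫) P := by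
    intro i
    refine Integrable.of_bound (hw'.inner
      ((hG.comp (hx'.prodMk (hZ.measurable _))).sub (hm.comp hx'))).aestronglyMeasurable (b * s)
      (ae_of_all _ fun ω => (norm_inner_le_norm _ _).trans ?_)
    exact mul_le_mul (hb ω) (hs _ (hxX ω) _) (norm_nonneg _) ((norm_nonneg _).trans (hb ω))
  simp_rw [batchMean_sub hn, inner_smul_right, inner_sum]
  rw [integral_const_mul, integral_finsetSum _ fun i _ => hint i, abs_mul]
  have hn' : (0 : ℝ) < n := by positivity
  -- Since `x` and `w` are known at time `T`, the `i`-th term decays with the lag `i` and the sum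
  -- stays bounded in `n`; `2 * 4/3` is rounded up to `3`.
  have hsum : |∑ i ∈ Finset.Icc 1 n,
      ∫ ω, ⟪w ω, G (x ω) (Z (T + i) ω) - meanOp G π (x ω)⟫ ∂P| ≤ 3 * τ * (b * s) := by
    calc _ ≤ ∑ i ∈ Finset.Icc 1 n, 2 * (1 / 4 : ℝ) ^ (i / τ) * (b * s) :=
          (Finset.abs_sum_le_sum_abs _ _).trans (Finset.sum_le_sum fun i _ =>
            hZ.abs_integral_inner_le hQ hG hs T i hx hw hxX hb)
      _ = 2 * (∑ i ∈ Finset.Icc 1 n, (1 / 4 : ℝ) ^ (i / τ)) * (b * s) := by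
          rw [Finset.mul_sum, Finset.sum_mul]
      _ ≤ 2 * (4 / 3 * τ) * (b * s) := by
          gcongr
          exact sum_mixing_le hQ.1 (Finset.Icc 1 n) (f := fun i => i) (fun _ _ _ _ h => h)
      _ ≤ 3 * τ * (b * s) := by
          have : 0 ≤ τ * (b * s) := by positivity
          linarith
  calc _ ≤ |(n : ℝ)⁻¹| * (3 * τ * (b * s)) := by gcongr
    _ = 3 * τ / n * (b * s) := by
        rw [abs_of_nonneg (by positivity)]
        field_simp

end Batch

/-! ### Realizations of the method -/

section Algorithm

variable {E S : Type*} [NormedAddCommGroup E] [InnerProductSpace ℝ E]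

/-- The sample counter `T^k` as a function of the batch levels. -/
def clock (B : ℕ) (j : ℕ → ℕ) : ℕ → ℕ
  | 0 => 0
  | k + 1 => clock B j k + B + 2 ^ j k * B

/-- The error of the batch average at `x^k`, relative to the operator `m`. -/
def batchErr (m : E → E) (G : E → S → E) (r : E → ℝ) (X : Set E) (γ : ℝ) (B : ℕ) (M : ℝ) (x₀ : E)
    (z : ℕ → S) (j : ℕ → ℕ) (k : ℕ) : E :=
  batchMean G z (state G r X γ B M x₀ z j k).2 B (state G r X γ B M x₀ z j k).1 -
    m (state G r X γ B M x₀ z j k).1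

/-- The error of the randomized estimate at `x^{k+1/2}`, relative to the operator `m`. -/
def estErr (m : E → E) (G : E → S → E) (r : E → ℝ) (X : Set E) (γ : ℝ) (B : ℕ) (M : ℝ) (x₀ : E)
    (z : ℕ → S) (j : ℕ → ℕ) (k : ℕ) : E :=
  m (halfIterate G r X γ B M x₀ z j k) -
    randEstimate G z ((state G r X γ B M x₀ z j k).2 + B) B M (j k)
      (halfIterate G r X γ B M x₀ z j k)

/-- The auxiliary sequence of projected steps along the errors of the randomized estimates. -/
def ghost (m : E → E) (G : E → S → E) (r : E → ℝ) (X : Set E) (γ : ℝ) (B : ℕ) (M : ℝ) (x₀ : E)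
    (z : ℕ → S) (j : ℕ → ℕ) : ℕ → E
  | 0 => x₀
  | k + 1 => prox X (fun _ => 0) 1
      (ghost m G r X γ B M x₀ z j k - γ • estErr m G r X γ B M x₀ z j k)

variable {m : E → E} {G : E → S → E} {F : E → E} {r : E → ℝ} {X : Set E} {γ : ℝ} {B : ℕ} {M : ℝ}
  {x₀ : E}

theorem state_snd (z : ℕ → S) (j : ℕ → ℕ) (k : ℕ) :
    (state G r X γ B M x₀ z j k).2 = clock B j k := by
  induction k with
  | zero => rfl
  | succ k ih => simp only [state, clock, ih]

theorem clock_congr {j j' : ℕ → ℕ} {k : ℕ} (h : ∀ i < k, j i = j' i) :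
    clock B j k = clock B j' k := by
  induction k with
  | zero => rfl
  | succ k ih => simp only [clock, ih fun i hi => h i (by omega), h k (by omega)]

theorem batchMean_congr {z z' : ℕ → S} {T n : ℕ} (h : ∀ i ≤ T + n, z i = z' i) (x : E) :
    batchMean G z T n x = batchMean G z' T n x := by
  unfold batchMean
  congr 1
  refine Finset.sum_congr rfl fun i hi => ?_
  rw [h (T + i) (by have := (Finset.mem_Icc.1 hi).2; omega)]

theorem randEstimate_congr {z z' : ℕ → S} {T j : ℕ} (h : ∀ i ≤ T + 2 ^ j * B, z i = z' i)
    (x : E) : randEstimate G z T B M j x = randEstimate G z' T B M j x := by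
  have h1 : ∀ l ≤ j, batchMean G z T (2 ^ l * B) x = batchMean G z' T (2 ^ l * B) x := by
    intro l hl
    refine batchMean_congr (fun i hi => h i (hi.trans ?_)) x
    gcongr
    norm_num
  unfold randEstimate
  rw [h1 0 (Nat.zero_le _), h1 j le_rfl, h1 (j - 1) (Nat.sub_le _ _)]

theorem extrapolate_congr {z z' : ℕ → S} {T : ℕ} (h : ∀ i ≤ T + B, z i = z' i) (x : E) :
    extrapolate G r X γ B z x T = extrapolate G r X γ B z' x T := by
  unfold extrapolate
  rw [batchMean_congr h]

/-- Causality: the first `k` iterations read only samples with index at most `clock B j k` and the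
first `k` levels. This and its companions yield measurability with respect to the past for fixed
levels. -/
theorem state_congr {z z' : ℕ → S} {j j' : ℕ → ℕ} {k : ℕ}
    (hz : ∀ i ≤ clock B j k, z i = z' i) (hj : ∀ i < k, j i = j' i) :
    state G r X γ B M x₀ z j k = state G r X γ B M x₀ z' j' k := by
  induction k with
  | zero => rfl
  | succ k ih =>
    have hz' : ∀ i ≤ clock B j k + B + 2 ^ j k * B, z i = z' i := hz
    have ih' := ih (fun i hi => hz' i (by omega)) (fun i hi => hj i (by omega))
    have h2 := state_snd (G := G) (r := r) (X := X) (γ := γ) (B := B) (M := M) (x₀ := x₀) z j k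
    simp only [state]
    rw [← ih', ← hj k (by omega), h2, extrapolate_congr (z' := z') (fun i hi => hz' i (by omega)),
      randEstimate_congr hz']

theorem halfIterate_congr {z z' : ℕ → S} {j j' : ℕ → ℕ} {k : ℕ}
    (hz : ∀ i ≤ clock B j k + B, z i = z' i) (hj : ∀ i < k, j i = j' i) :
    halfIterate G r X γ B M x₀ z j k = halfIterate G r X γ B M x₀ z' j' k := by
  have h1 := state_congr (G := G) (r := r) (X := X) (γ := γ) (B := B) (M := M) (x₀ := x₀)
    (fun i hi => hz i (by omega)) hj
  unfold halfIterate
  rw [← h1, state_snd, extrapolate_congr hz]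

theorem ghost_congr {z z' : ℕ → S} {j j' : ℕ → ℕ} {k : ℕ}
    (hz : ∀ i ≤ clock B j k, z i = z' i) (hj : ∀ i < k, j i = j' i) :
    ghost m G r X γ B M x₀ z j k = ghost m G r X γ B M x₀ z' j' k := by
  induction k with
  | zero => rfl
  | succ k ih =>
    have hz' : ∀ i ≤ clock B j k + B + 2 ^ j k * B, z i = z' i := hz
    have hj' : ∀ i < k, j i = j' i := fun i hi => hj i (by omega)
    simp only [ghost, estErr]
    rw [← ih (fun i hi => hz' i (by omega)) hj', ← hj k (by omega),
      ← halfIterate_congr (z := z) (fun i hi => hz' i (by omega)) hj', state_snd, state_snd,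
      ← clock_congr hj', randEstimate_congr hz']

/-! #### Feasibility -/

theorem isProx_halfIterate (hX : IsCompact X) (hr : LowerSemicontinuousOn r X) (hγ : 0 < γ)
    (hx₀ : x₀ ∈ X) (z : ℕ → S) (j : ℕ → ℕ) (k : ℕ) :
    IsProx X r γ ((state G r X γ B M x₀ z j k).1 -
      γ • batchMean G z (state G r X γ B M x₀ z j k).2 B (state G r X γ B M x₀ z j k).1)
      (halfIterate G r X γ B M x₀ z j k) :=
  isProx_prox hX ⟨x₀, hx₀⟩ hr hγ _

theorem isProx_state_succ (hX : IsCompact X) (hr : LowerSemicontinuousOn r X) (hγ : 0 < γ)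
    (hx₀ : x₀ ∈ X) (z : ℕ → S) (j : ℕ → ℕ) (k : ℕ) :
    IsProx X r γ ((state G r X γ B M x₀ z j k).1 -
      γ • randEstimate G z ((state G r X γ B M x₀ z j k).2 + B) B M (j k)
        (halfIterate G r X γ B M x₀ z j k)) (state G r X γ B M x₀ z j (k + 1)).1 :=
  isProx_prox hX ⟨x₀, hx₀⟩ hr hγ _

theorem isProx_ghost_succ (hX : IsCompact X) (hx₀ : x₀ ∈ X) (z : ℕ → S) (j : ℕ → ℕ) (k : ℕ) :
    IsProx X (fun _ => 0) 1
      (ghost m G r X γ B M x₀ z j k - γ • estErr m G r X γ B M x₀ z j k)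
      (ghost m G r X γ B M x₀ z j (k + 1)) :=
  isProx_prox hX ⟨x₀, hx₀⟩ continuousOn_const.lowerSemicontinuousOn one_pos _

theorem state_fst_mem (hX : IsCompact X) (hr : LowerSemicontinuousOn r X) (hγ : 0 < γ)
    (hx₀ : x₀ ∈ X) (z : ℕ → S) (j : ℕ → ℕ) (k : ℕ) : (state G r X γ B M x₀ z j k).1 ∈ X := by
  cases k with
  | zero => exact hx₀
  | succ k => exact (isProx_state_succ hX hr hγ hx₀ z j k).1

theorem ghost_mem (hX : IsCompact X) (hx₀ : x₀ ∈ X) (z : ℕ → S) (j : ℕ → ℕ) (k : ℕ) :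
    ghost m G r X γ B M x₀ z j k ∈ X := by
  cases k with
  | zero => exact hx₀
  | succ k => exact (isProx_ghost_succ hX hx₀ z j k).1

theorem averagedIterate_mem (hX : IsCompact X) (hXc : Convex ℝ X) (hr : LowerSemicontinuousOn r X)
    (hγ : 0 < γ) (hx₀ : x₀ ∈ X) (z : ℕ → S) (j : ℕ → ℕ) {N : ℕ} (hN : 1 ≤ N) :
    averagedIterate G r X γ B M x₀ z j N ∈ X := by
  unfold averagedIterate
  rw [Finset.smul_sum]
  refine hXc.sum_mem (fun _ _ => by positivity) ?_
    fun k _ => (isProx_halfIterate hX hr hγ hx₀ z j k).1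
  have : (N : ℝ) ≠ 0 := by positivity
  simp [this]

/-! #### The bound along a realization -/

/-- A bound on the gap of the averaged iterate, for every realization of the noise. -/
theorem gap_averagedIterate_le {L D : ℝ} (hX : IsCompact X) (hXD : ∀ x ∈ X, ∀ y ∈ X,
    ‖x - y‖ ^ 2 ≤ D ^ 2) (hL : 0 < L) (hF : ∀ x ∈ X, ∀ y ∈ X, ‖F x - F y‖ ≤ L * ‖x - y‖)
    (hmono : ∀ x ∈ X, ∀ y ∈ X, 0 ≤ ⟪F x - F y, x - y⟫) (hc : ConvexOn ℝ X r)
    (hr : LowerSemicontinuousOn r X) (hm : ∀ x ∈ X, m x = F x) (hx₀ : x₀ ∈ X) (hγ : 0 < γ)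
    (hγL : γ ≤ 1 / 2 / L) {N : ℕ} (hN : 1 ≤ N) (z : ℕ → S) (j : ℕ → ℕ) :
    gap F r X (averagedIterate G r X γ B M x₀ z j N) ≤ (γ * N)⁻¹ * (D ^ 2 +
      ∑ k ∈ Finset.range N, (3 * γ ^ 2 / 2 * ‖batchErr m G r X γ B M x₀ z j k‖ ^ 2 +
        2 * γ ^ 2 * ‖estErr m G r X γ B M x₀ z j k‖ ^ 2 +
        γ * ⟪estErr m G r X γ B M x₀ z j k,
          halfIterate G r X γ B M x₀ z j k - ghost m G r X γ B M x₀ z j k⟫)) := by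
  set x : ℕ → E := fun k => (state G r X γ B M x₀ z j k).1 with hx
  set h : ℕ → E := fun k => halfIterate G r X γ B M x₀ z j k with hh
  set u : ℕ → E := fun k => ghost m G r X γ B M x₀ z j k with hu
  set a : ℕ → E := fun k => batchErr m G r X γ B M x₀ z j k with ha
  set e : ℕ → E := fun k => estErr m G r X γ B M x₀ z j k with he
  have hhX : ∀ k, h k ∈ X := fun k => (isProx_halfIterate hX hr hγ hx₀ z j k).1
  have hxX : ∀ k, x k ∈ X := fun k => state_fst_mem hX hr hγ hx₀ z j k
  have hN' : (0 : ℝ) < N := by positivity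
  refine gap_le ⟨x₀, hx₀⟩ fun y hy => ?_
  -- The coefficient `2 * γ ^ 2` of `‖e k‖²` is `3γ²/2` from the extragradient step plus `γ²/2` from
  -- the ghost step.
  have hstep : ∀ k, γ * (⟪F y, h k - y⟫ + r (h k) - r y) ≤
      (1 / 2 * ‖x k - y‖ ^ 2 + 1 / 2 * ‖u k - y‖ ^ 2) -
      (1 / 2 * ‖x (k + 1) - y‖ ^ 2 + 1 / 2 * ‖u (k + 1) - y‖ ^ 2) +
      (3 * γ ^ 2 / 2 * ‖a k‖ ^ 2 + 2 * γ ^ 2 * ‖e k‖ ^ 2 + γ * ⟪e k, h k - u k⟫) := by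
    intro k
    have h1 := extragradient_step_monotone_le hc hL hF hmono hγ.le hγL (hxX k)
      (isProx_halfIterate hX hr hγ hx₀ z j k) (isProx_state_succ (B := B) (M := M) (G := G)
        hX hr hγ hx₀ z j k) hy
    have h2 := ghost_step_le hc.1 (isProx_ghost_succ (m := m) (G := G) (r := r) (γ := γ) (B := B)
      (M := M) hX hx₀ z j k) hy
    have e1 : batchMean G z (state G r X γ B M x₀ z j k).2 B (state G r X γ B M x₀ z j k).1 -
        F (state G r X γ B M x₀ z j k).1 = a k := by
      rw [← hm _ (hxX k)]
      rfl
    have e2 : randEstimate G z ((state G r X γ B M x₀ z j k).2 + B) B M (j k)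
        (halfIterate G r X γ B M x₀ z j k) - F (halfIterate G r X γ B M x₀ z j k) = - e k := by
      rw [← hm _ (hhX k), ← neg_sub]
      rfl
    rw [e1, e2, norm_neg, inner_neg_left] at h1
    have h3 : ⟪e k, h k - y⟫ = ⟪e k, h k - u k⟫ + ⟪e k, u k - y⟫ := by
      rw [← inner_add_right]
      congr 1
      abel
    have h4 : γ * ⟪e k, h k - y⟫ = γ * ⟪e k, h k - u k⟫ + γ * ⟪e k, u k - y⟫ := by rw [h3, mul_add]
    have h1' : γ * (⟪F y, h k - y⟫ + r (h k) - r y) ≤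
      1 / 2 * ‖x k - y‖ ^ 2 - 1 / 2 * ‖x (k + 1) - y‖ ^ 2 +
        3 * γ ^ 2 / 2 * (‖a k‖ ^ 2 + ‖e k‖ ^ 2) - γ * -⟪e k, h k - y⟫ := h1
    have h2' : γ * ⟪e k, u k - y⟫ ≤
      1 / 2 * ‖u k - y‖ ^ 2 - 1 / 2 * ‖u (k + 1) - y‖ ^ 2 + γ ^ 2 / 2 * ‖e k‖ ^ 2 := h2
    linarith
  have hsum := Finset.sum_le_sum fun k (_ : k ∈ Finset.range N) => hstep k
  rw [Finset.sum_add_distrib, Finset.sum_range_sub'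
    (fun k => 1 / 2 * ‖x k - y‖ ^ 2 + 1 / 2 * ‖u k - y‖ ^ 2), ← Finset.mul_sum] at hsum
  have h0 : ‖x 0 - y‖ ^ 2 ≤ D ^ 2 := hXD _ (hxX 0) y hy
  have h0' : ‖u 0 - y‖ ^ 2 ≤ D ^ 2 := hXD _ (ghost_mem hX hx₀ z j 0) y hy
  have hxN : 0 ≤ ‖x N - y‖ ^ 2 := by positivity
  have huN : 0 ≤ ‖u N - y‖ ^ 2 := by positivity
  have havg : averagedIterate G r X γ B M x₀ z j N = ∑ k ∈ Finset.range N, (N : ℝ)⁻¹ • h k := by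
    rw [averagedIterate, Finset.smul_sum]
  have hw : ∑ _k ∈ Finset.range N, (N : ℝ)⁻¹ = 1 := by simp [hN'.ne']
  have hrle : r (averagedIterate G r X γ B M x₀ z j N) ≤
      ∑ k ∈ Finset.range N, (N : ℝ)⁻¹ • r (h k) := by
    rw [havg]
    exact hc.map_sum_le (fun _ _ => by positivity) hw fun k _ => hhX k
  have hconv : ⟪F y, averagedIterate G r X γ B M x₀ z j N - y⟫ +
      r (averagedIterate G r X γ B M x₀ z j N) - r y ≤
      (N : ℝ)⁻¹ * ∑ k ∈ Finset.range N, (⟪F y, h k - y⟫ + r (h k) - r y) := by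
    have e1 : averagedIterate G r X γ B M x₀ z j N - y =
        ∑ k ∈ Finset.range N, (N : ℝ)⁻¹ • (h k - y) := by
      simp_rw [smul_sub]
      rw [Finset.sum_sub_distrib, ← Finset.sum_smul, hw, one_smul, havg]
    rw [e1, inner_sum]
    simp_rw [inner_smul_right]
    have e2 : r y = ∑ k ∈ Finset.range N, (N : ℝ)⁻¹ * r y := by
      rw [← Finset.sum_mul, hw, one_mul]
    rw [e2]
    refine (sub_le_sub_right (add_le_add_right hrle _) _).trans (le_of_eq ?_)
    rw [← Finset.sum_add_distrib, ← Finset.sum_sub_distrib, Finset.mul_sum]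
    refine Finset.sum_congr rfl fun k _ => ?_
    rw [smul_eq_mul, ← e2]
    ring
  refine hconv.trans ?_
  rw [mul_inv, mul_comm γ⁻¹, mul_assoc]
  gcongr
  rw [le_inv_mul_iff₀ hγ]
  linarith

end Algorithm

/-! ### Measurability -/

section Measurability

theorem measurable_of_countable_index {Ω ι β : Type*} {mΩ : MeasurableSpace Ω} [MeasurableSpace β]
    [MeasurableSpace ι] [Countable ι] [MeasurableSingletonClass ι] {f : ι → Ω → β}
    (hf : ∀ i, Measurable (f i)) {T : Ω → ι} (hT : Measurable T) :
    Measurable fun ω => f (T ω) ω := by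
  have h : Measurable fun p : ι × Ω => f p.1 p.2 := measurable_from_prod_countable_right hf
  exact h.comp (hT.prodMk measurable_id)

variable {E S Ω : Type*} [NormedAddCommGroup E] [InnerProductSpace ℝ E] [FiniteDimensional ℝ E]
  [MeasurableSpace E] [BorelSpace E] [MeasurableSpace S] {mΩ : MeasurableSpace Ω}
  {m : E → E} {G : E → S → E} {r : E → ℝ} {X : Set E} {γ : ℝ} {B : ℕ} {M : ℝ} {x₀ : E}
  {Z : ℕ → Ω → S} {J : ℕ → Ω → ℕ}

theorem measurable_batchMean (hG : Measurable (Function.uncurry G)) (hZ : ∀ i, Measurable (Z i))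
    {T : Ω → ℕ} (hT : Measurable T) (n : ℕ) {x : Ω → E} (hx : Measurable x) :
    Measurable fun ω => batchMean G (fun i => Z i ω) (T ω) n (x ω) := by
  refine measurable_of_countable_index
    (f := fun T ω => batchMean G (fun i => Z i ω) T n (x ω)) (fun T => ?_) hT
  unfold batchMean
  refine (Finset.measurable_fun_sum _ fun i _ => ?_).const_smul _
  exact hG.comp (hx.prodMk (hZ _))

theorem measurable_randEstimate (hG : Measurable (Function.uncurry G))
    (hZ : ∀ i, Measurable (Z i)) {T j : Ω → ℕ} (hT : Measurable T) (hj : Measurable j) {x : Ω → E}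
    (hx : Measurable x) :
    Measurable fun ω => randEstimate G (fun i => Z i ω) (T ω) B M (j ω) (x ω) := by
  refine measurable_of_countable_index
    (f := fun j ω => randEstimate G (fun i => Z i ω) (T ω) B M j (x ω)) (fun j => ?_) hj
  unfold randEstimate
  refine (measurable_batchMean hG hZ hT _ hx).add ?_
  split_ifs
  · exact ((measurable_batchMean hG hZ hT _ hx).sub
      (measurable_batchMean hG hZ hT _ hx)).const_smul _
  · exact measurable_const

theorem measurable_extrapolate (hp : Measurable (prox X r γ)) (hG : Measurable (Function.uncurry G))
    (hZ : ∀ i, Measurable (Z i)) {T : Ω → ℕ} (hT : Measurable T) {x : Ω → E}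
    (hx : Measurable x) :
    Measurable fun ω => extrapolate G r X γ B (fun i => Z i ω) (x ω) (T ω) :=
  hp.comp (hx.sub ((measurable_batchMean hG hZ hT _ hx).const_smul γ))

theorem measurable_state (hp : Measurable (prox X r γ)) (hG : Measurable (Function.uncurry G))
    (hZ : ∀ i, Measurable (Z i)) (hJ : ∀ k, Measurable (J k)) (k : ℕ) :
    Measurable fun ω => state G r X γ B M x₀ (fun i => Z i ω) (fun k => J k ω) k := by
  induction k with
  | zero => exact measurable_const
  | succ k ih =>
    simp only [state]
    refine Measurable.prodMk (hp.comp (ih.fst.sub ((measurable_randEstimate hG hZ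
      (ih.snd.add_const B) (hJ k) ?_).const_smul γ))) ?_
    · exact measurable_extrapolate hp hG hZ ih.snd ih.fst
    · exact (ih.snd.add_const B).add
        ((measurable_from_top (f := fun j : ℕ => 2 ^ j * B)).comp (hJ k))

theorem measurable_halfIterate (hp : Measurable (prox X r γ))
    (hG : Measurable (Function.uncurry G))
    (hZ : ∀ i, Measurable (Z i)) (hJ : ∀ k, Measurable (J k)) (k : ℕ) :
    Measurable fun ω => halfIterate G r X γ B M x₀ (fun i => Z i ω) (fun k => J k ω) k :=
  measurable_extrapolate hp hG hZ (measurable_state hp hG hZ hJ k).snd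
    (measurable_state hp hG hZ hJ k).fst

theorem measurable_batchErr (hm : Measurable m) (hp : Measurable (prox X r γ))
    (hG : Measurable (Function.uncurry G))
    (hZ : ∀ i, Measurable (Z i)) (hJ : ∀ k, Measurable (J k)) (k : ℕ) :
    Measurable fun ω => batchErr m G r X γ B M x₀ (fun i => Z i ω) (fun k => J k ω) k := by
  have h := measurable_state (B := B) (M := M) (x₀ := x₀) hp hG hZ hJ k
  exact (measurable_batchMean hG hZ h.snd B h.fst).sub (hm.comp h.fst)

theorem measurable_estErr (hm : Measurable m) (hp : Measurable (prox X r γ))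
    (hG : Measurable (Function.uncurry G))
    (hZ : ∀ i, Measurable (Z i)) (hJ : ∀ k, Measurable (J k)) (k : ℕ) :
    Measurable fun ω => estErr m G r X γ B M x₀ (fun i => Z i ω) (fun k => J k ω) k := by
  have h := measurable_halfIterate (B := B) (M := M) (x₀ := x₀) hp hG hZ hJ k
  exact (hm.comp h).sub (measurable_randEstimate hG hZ
    ((measurable_state hp hG hZ hJ k).snd.add_const B) (hJ k) h)

theorem measurable_ghost (hm : Measurable m) (hp : Measurable (prox X r γ))
    (hp₀ : Measurable (prox X (fun _ => 0) 1)) (hG : Measurable (Function.uncurry G))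
    (hZ : ∀ i, Measurable (Z i)) (hJ : ∀ k, Measurable (J k)) (k : ℕ) :
    Measurable fun ω => ghost m G r X γ B M x₀ (fun i => Z i ω) (fun k => J k ω) k := by
  induction k with
  | zero => exact measurable_const
  | succ k ih => exact hp₀.comp (ih.sub ((measurable_estErr hm hp hG hZ hJ k).const_smul γ))

/-- Capping every sample index at the clock changes nothing by causality and makes every sample
measurable with respect to the past; ordinary measurability is then applied over that smaller
σ-algebra. -/
theorem measurable_past_state_fst (hp : Measurable (prox X r γ))
    (hG : Measurable (Function.uncurry G)) (Z : ℕ → Ω → S) (j : ℕ → ℕ) (k : ℕ) :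
    Measurable[past Z (clock B j k)]
      fun ω => (state G r X γ B M x₀ (fun i => Z i ω) j k).1 := by
  have h := (measurable_state (mΩ := past Z (clock B j k)) (B := B) (M := M) (x₀ := x₀)
    (Z := fun i => Z (min i (clock B j k))) (J := fun k _ => j k) hp hG
    (fun i => measurable_past (min_le_right _ _)) (fun k => measurable_const) k).fst
  convert h using 2 with ω
  exact congrArg Prod.fst (state_congr (fun i hi => by rw [min_eq_left hi]) fun _ _ => rfl)

theorem measurable_past_halfIterate (hp : Measurable (prox X r γ))
    (hG : Measurable (Function.uncurry G)) (Z : ℕ → Ω → S) (j : ℕ → ℕ) (k : ℕ) :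
    Measurable[past Z (clock B j k + B)]
      fun ω => halfIterate G r X γ B M x₀ (fun i => Z i ω) j k := by
  have h := measurable_halfIterate (mΩ := past Z (clock B j k + B)) (B := B) (M := M) (x₀ := x₀)
    (Z := fun i => Z (min i (clock B j k + B))) (J := fun k _ => j k) hp hG
    (fun i => measurable_past (min_le_right _ _)) (fun k => measurable_const) k
  convert h using 2 with ω
  exact halfIterate_congr (fun i hi => by rw [min_eq_left hi]) fun _ _ => rfl

/-- The extra `B` in the time index matches that of `halfIterate`, so that the difference of the two
is measurable at one common time. -/
theorem measurable_past_ghost (hm : Measurable m) (hp : Measurable (prox X r γ))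
    (hp₀ : Measurable (prox X (fun _ => 0) 1))
    (hG : Measurable (Function.uncurry G)) (Z : ℕ → Ω → S) (j : ℕ → ℕ) (k : ℕ) :
    Measurable[past Z (clock B j k + B)]
      fun ω => ghost m G r X γ B M x₀ (fun i => Z i ω) j k := by
  have h := measurable_ghost (mΩ := past Z (clock B j k + B)) (B := B) (M := M) (x₀ := x₀)
    (Z := fun i => Z (min i (clock B j k + B))) (J := fun k _ => j k) hm hp hp₀ hG
    (fun i => measurable_past (min_le_right _ _)) (fun k => measurable_const) k
  convert h using 2 with ω
  exact ghost_congr (fun i hi => by rw [min_eq_left (by omega)]) fun _ _ => rfl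

end Measurability

/-! ### Independent batch levels -/

section Levels

variable {S Ω : Type*} [MeasurableSpace S] [MeasurableSpace Ω] {P : Measure Ω}
  [IsProbabilityMeasure P]

/-- For independent `U` and `V`, the mean of `f (U, V)` is an iterated integral. -/
theorem integral_eq_of_indepFun {α β : Type*} [MeasurableSpace α] [MeasurableSpace β]
    {U : Ω → α} {V : Ω → β} (hU : Measurable U)
    (hV : Measurable V) (h : IndepFun U V P) {f : α × β → ℝ} (hf : Measurable f) {c : ℝ}
    (hc : ∀ p, |f p| ≤ c) :
    ∫ ω, f (U ω, V ω) ∂P = ∫ ω', ∫ ω, f (U ω, V ω') ∂P ∂P := by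
  have hpU := Measure.isProbabilityMeasure_map hU.aemeasurable (μ := P)
  have hpV := Measure.isProbabilityMeasure_map hV.aemeasurable (μ := P)
  have h1 := h.map_prod_eq_prod_map_map hU.aemeasurable hV.aemeasurable
  have hint : Integrable f ((P.map U).prod (P.map V)) :=
    Integrable.of_bound hf.aestronglyMeasurable c (ae_of_all _ hc)
  have h2 : ∫ ω, f (U ω, V ω) ∂P = ∫ p, f p ∂(P.map fun ω => (U ω, V ω)) :=
    (integral_map (hU.prodMk hV).aemeasurable hf.aestronglyMeasurable).symm
  rw [h2, h1, integral_prod_symm f hint, integral_map hV.aemeasurable]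
  · refine integral_congr_ae (ae_of_all _ fun ω' => ?_)
    exact integral_map hU.aemeasurable
      (hf.comp (measurable_id.prodMk measurable_const)).aestronglyMeasurable
  · exact hf.stronglyMeasurable.integral_prod_left'.aestronglyMeasurable

variable {J : ℕ → Ω → ℕ} {Z : ℕ → Ω → S}

/-- A level is independent of the chain and the previous levels. -/
theorem IsIIDGeomHalf.integral_ite_mul (hJ : IsIIDGeomHalf P J) (hZ : ∀ n, Measurable (Z n))
    (hZJ : IndepFun (fun ω n => Z n ω) (fun ω k => J k ω) P) (k : ℕ) {i : ℕ} (hi : 1 ≤ i)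
    {f : (ℕ → S) × (ℕ → ℕ) → ℝ} (hf : Measurable f) {c : ℝ} (hc : ∀ p, |f p| ≤ c)
    (hdep : ∀ z j j', (∀ l < k, j l = j' l) → f (z, j) = f (z, j')) :
    ∫ ω, (if J k ω = i then 1 else 0) * f (fun n => Z n ω, fun k => J k ω) ∂P =
      (1 / 2 : ℝ) ^ i * ∫ ω, f (fun n => Z n ω, fun k => J k ω) ∂P := by
  have hZm : Measurable fun ω n => Z n ω := measurable_pi_lambda _ hZ
  have hJm : Measurable fun ω k => J k ω := measurable_pi_lambda _ hJ.measurable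
  have hind : Measurable fun l : ℕ => if l = i then (1 : ℝ) else 0 := measurable_from_top
  -- Keeping the first `k` levels and filling in `0` exhibits the chain-averaged `φ` as a function
  -- of `J 0, …, J (k - 1)`, hence independent of `J k`.
  set t : (Finset.range k → ℕ) → ℕ → ℕ :=
    fun a l => if h : l ∈ Finset.range k then a ⟨l, h⟩ else 0 with ht
  have htm : Measurable t := by
    refine measurable_pi_lambda _ fun l => ?_
    by_cases h : l ∈ Finset.range k
    · simp only [ht, h, dite_true]
      exact measurable_pi_apply _
    · simp only [ht, h, dite_false]
      exact measurable_const
  have htr : ∀ (z : ℕ → S) (j : ℕ → ℕ), f (z, j) = f (z, t fun l => j l) := by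
    intro z j
    refine hdep z _ _ fun l hl => ?_
    simp [ht, hl]
  set φ : (ℕ → ℕ) → ℝ := fun j => ∫ ω, f (fun n => Z n ω, j) ∂P with hφ
  have hφm : Measurable φ := by
    have : Measurable fun p : (ℕ → ℕ) × Ω => f (fun n => Z n p.2, p.1) :=
      hf.comp ((hZm.comp measurable_snd).prodMk measurable_fst)
    exact this.stronglyMeasurable.integral_prod_right.measurable
  have hφt : ∀ j, φ j = φ (t fun l => j l) := fun j =>
    integral_congr_ae (ae_of_all _ fun ω => htr _ j)
  have hindep : IndepFun (fun ω => if J k ω = i then (1 : ℝ) else 0)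
      (fun ω => φ fun k => J k ω) P := by
    have h1 := hJ.indep.indepFun_finset {k} (Finset.range k) (by simp) hJ.measurable
    have h2 := h1.comp (φ := fun a : ({k} : Finset ℕ) → ℕ => if a ⟨k, by simp⟩ = i then (1 : ℝ) else 0)
      (ψ := fun a => φ (t a)) (hind.comp (measurable_pi_apply _)) (hφm.comp htm)
    have h3 : (fun ω => φ fun k => J k ω) =
        (fun a => φ (t a)) ∘ fun ω (l : Finset.range k) => J l ω := funext fun ω => hφt _
    rw [h3]
    exact h2
  have h1 := integral_eq_of_indepFun hZm hJm hZJ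
    (f := fun p => (if p.2 k = i then (1 : ℝ) else 0) * f p) (c := c)
    ((hind.comp ((measurable_pi_apply k).comp measurable_snd)).mul hf) (fun p => by
      have := (abs_nonneg _).trans (hc p)
      split_ifs <;> simp [hc p, this])
  have h2 := integral_eq_of_indepFun hZm hJm hZJ hf hc
  rw [h1, h2]
  change ∫ ω', ∫ ω, (if J k ω' = i then (1 : ℝ) else 0) *
    f (fun n => Z n ω, fun k => J k ω') ∂P ∂P = (1 / 2) ^ i * ∫ ω', φ (fun k => J k ω') ∂P
  have h4 : ∀ ω', ∫ ω, (if J k ω' = i then (1 : ℝ) else 0) *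
      f (fun n => Z n ω, fun k => J k ω') ∂P =
      (if J k ω' = i then (1 : ℝ) else 0) * φ (fun k => J k ω') :=
    fun ω' => integral_const_mul _ _
  simp_rw [h4]
  rw [hindep.integral_fun_mul_eq_mul_integral
    (hind.comp (hJ.measurable k)).aestronglyMeasurable (hφm.comp hJm).aestronglyMeasurable]
  congr 1
  have h3 : (fun ω => if J k ω = i then (1 : ℝ) else 0) =
      (J k ⁻¹' {i}).indicator fun _ => (1 : ℝ) := by
    ext ω
    simp [Set.indicator]
  rw [h3, integral_indicator_const _ (hJ.measurable k (measurableSet_singleton i)), smul_eq_mul,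
    mul_one, Measure.real, hJ.law k i hi]
  simp

end Levels

/-! ### Expected errors of the estimates -/

section ErrorBounds

variable {E S : Type*} [NormedAddCommGroup E] [InnerProductSpace ℝ E]

/-- The factor `2^j` if `2^j ≤ M`, and `0` otherwise. -/
def levelFactor (M : ℝ) (j : ℕ) : ℝ :=
  if (2 : ℝ) ^ j ≤ M then 2 ^ j else 0

theorem levelFactor_nonneg (M : ℝ) (j : ℕ) : 0 ≤ levelFactor M j := by
  unfold levelFactor
  split_ifs <;> positivity

theorem levelFactor_le {M : ℝ} (hM : 0 ≤ M) (j : ℕ) : levelFactor M j ≤ M := by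
  unfold levelFactor
  split_ifs <;> assumption

/-- One factor `2 ^ j` is split off so that it can cancel the batch length `2 ^ j * B` in the
variance. -/
theorem levelFactor_sq (M : ℝ) (j : ℕ) : levelFactor M j ^ 2 = levelFactor M j * 2 ^ j := by
  unfold levelFactor
  split_ifs <;> ring

theorem randEstimate_eq (G : E → S → E) (z : ℕ → S) (T B : ℕ) (M : ℝ) (j : ℕ) (x : E) :
    randEstimate G z T B M j x = batchMean G z T (2 ^ 0 * B) x +
      levelFactor M j • (batchMean G z T (2 ^ j * B) x - batchMean G z T (2 ^ (j - 1) * B) x) := by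
  unfold randEstimate levelFactor
  split_ifs <;> simp

theorem norm_batchMean_sub_le {G : E → S → E} {x m : E} {s : ℝ} (hs : ∀ z, ‖G x z - m‖ ≤ s)
    (z : ℕ → S) (T : ℕ) {n : ℕ} (hn : 1 ≤ n) : ‖batchMean G z T n x - m‖ ≤ s := by
  have hn' : (0 : ℝ) < n := by positivity
  rw [batchMean_sub hn, norm_smul, norm_inv, Real.norm_of_nonneg hn'.le, inv_mul_le_iff₀ hn']
  calc _ ≤ ∑ i ∈ Finset.Icc 1 n, s := norm_sum_le_of_le _ fun i _ => hs _
    _ = n * s := by simp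

theorem norm_sub_randEstimate_le {G : E → S → E} {x m : E} {s : ℝ} (hs : ∀ z, ‖G x z - m‖ ≤ s)
    (z : ℕ → S) (T : ℕ) {B : ℕ} (hB : 1 ≤ B) {M : ℝ} (hM : 0 ≤ M) (j : ℕ) :
    ‖m - randEstimate G z T B M j x‖ ≤ s + M * (s + s) := by
  have h1 : ∀ i, ‖batchMean G z T (2 ^ i * B) x - m‖ ≤ s := fun i =>
    norm_batchMean_sub_le hs z T (Nat.mul_pos (by positivity) hB)
  have h2 : ‖batchMean G z T (2 ^ j * B) x - batchMean G z T (2 ^ (j - 1) * B) x‖ ≤ s + s := by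
    rw [← sub_sub_sub_cancel_right _ _ m]
    exact (norm_sub_le _ _).trans (add_le_add (h1 _) (h1 _))
  rw [norm_sub_rev, randEstimate_eq, add_sub_right_comm]
  refine (norm_add_le _ _).trans (add_le_add (h1 0) ?_)
  rw [norm_smul, Real.norm_of_nonneg (levelFactor_nonneg M j)]
  exact mul_le_mul (levelFactor_le hM j) h2 (norm_nonneg _) hM

theorem norm_sub_randEstimate_sq_le (G : E → S → E) (z : ℕ → S) (T B : ℕ) (M : ℝ) (j : ℕ)
    (x m : E) :
    ‖m - randEstimate G z T B M j x‖ ^ 2 ≤ 3 * ‖batchMean G z T (2 ^ 0 * B) x - m‖ ^ 2 +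
      3 * levelFactor M j ^ 2 * ‖batchMean G z T (2 ^ j * B) x - m‖ ^ 2 +
      3 * levelFactor M j ^ 2 * ‖batchMean G z T (2 ^ (j - 1) * B) x - m‖ ^ 2 := by
  set a := batchMean G z T (2 ^ 0 * B) x - m with ha
  set b := batchMean G z T (2 ^ j * B) x - m with hb
  set c := batchMean G z T (2 ^ (j - 1) * B) x - m with hc
  set l := levelFactor M j with hl
  have hl0 : 0 ≤ l := levelFactor_nonneg M j
  have h1 : randEstimate G z T B M j x - m = a + l • b - l • c := by
    have hbc : b - c = batchMean G z T (2 ^ j * B) x - batchMean G z T (2 ^ (j - 1) * B) x :=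
      sub_sub_sub_cancel_right _ _ _
    rw [randEstimate_eq, ← hbc, smul_sub, ha]
    abel
  have h2 : ‖a + l • b - l • c‖ ≤ ‖a‖ + l * ‖b‖ + l * ‖c‖ := by
    refine (norm_sub_le _ _).trans (add_le_add ((norm_add_le _ _).trans (le_of_eq ?_)) (le_of_eq ?_))
    · rw [norm_smul, Real.norm_of_nonneg hl0]
    · rw [norm_smul, Real.norm_of_nonneg hl0]
  rw [norm_sub_rev, h1]
  have h3 := pow_le_pow_left₀ (norm_nonneg _) h2 2
  nlinarith [sq_nonneg (‖a‖ - l * ‖b‖), sq_nonneg (‖a‖ - l * ‖c‖), sq_nonneg (l * ‖b‖ - l * ‖c‖)]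

variable [FiniteDimensional ℝ E] [MeasurableSpace E] [BorelSpace E] [MeasurableSpace S]
  {Ω : Type*} [MeasurableSpace Ω]
  {P : Measure Ω} [IsProbabilityMeasure P] {Z : ℕ → Ω → S} {Q : Kernel S S}
  [IsMarkovKernel Q] {π : Measure S} [IsProbabilityMeasure π] {τ : ℕ} {G : E → S → E} {X : Set E}
  {s : ℝ} {J : ℕ → Ω → ℕ} {r : E → ℝ} {γ : ℝ} {B : ℕ} {M : ℝ} {x₀ : E}

/-- The squared weight times the variance leaves one factor `l` at level `j` and at most `2 * l` at
level `j - 1`, whose batch is half as long: hence `1 + l + 2 * l`, with `18 = 3 * 6`. -/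
theorem IsStationaryMarkovChain.integral_norm_sub_randEstimate_sq_le
    (hZ : IsStationaryMarkovChain P Z Q π)
    (hQ : HasMixingTime Q τ) (hG : Measurable (Function.uncurry G))
    (hs : ∀ x ∈ X, ∀ z, ‖G x z - meanOp G π x‖ ≤ s) (T : ℕ) (hB : 1 ≤ B) (M : ℝ) (j : ℕ)
    {x : Ω → E} (hx : Measurable[past Z T] x) (hxX : ∀ ω, x ω ∈ X) :
    ∫ ω, ‖meanOp G π (x ω) - randEstimate G (fun i => Z i ω) T B M j (x ω)‖ ^ 2 ∂P ≤
      18 * τ / B * s ^ 2 * (1 + 3 * levelFactor M j) := by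
  have hn : ∀ i, 1 ≤ 2 ^ i * B := fun i => Nat.mul_pos (by positivity) hB
  have hx' : Measurable x := hx.mono (past_le hZ.measurable _) le_rfl
  have hint : ∀ i, Integrable (fun ω => ‖batchMean G (fun i => Z i ω) T (2 ^ i * B) (x ω) -
      meanOp G π (x ω)‖ ^ 2) P := fun i => by
    refine Integrable.of_bound (((measurable_batchMean hG hZ.measurable measurable_const _ hx').sub
      ((measurable_meanOp hG π).comp hx')).norm.pow_const 2).aestronglyMeasurable (s ^ 2)
      (ae_of_all _ fun ω => ?_)
    rw [Real.norm_of_nonneg (by positivity)]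
    exact pow_le_pow_left₀ (norm_nonneg _) (norm_batchMean_sub_le (hs _ (hxX ω)) _ T (hn i)) 2
  have hb : ∀ i, ∫ ω, ‖batchMean G (fun i => Z i ω) T (2 ^ i * B) (x ω) - meanOp G π (x ω)‖ ^ 2 ∂P ≤
      6 * τ / (2 ^ i * B) * s ^ 2 := fun i => by
    simpa using hZ.integral_norm_batchMean_sub_sq_le hQ hG hs T (hn i) hx hxX
  set l := levelFactor M j with hl
  have hl0 : 0 ≤ l := levelFactor_nonneg M j
  have hB' : (0 : ℝ) < B := by positivity
  -- An inequality rather than an equality because of `j = 0`, where `j - 1 = 0`.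
  have hpow : (2 : ℝ) ^ j ≤ 2 * 2 ^ (j - 1) := by
    rw [← pow_succ']
    gcongr
    · norm_num
    · omega
  calc _ ≤ ∫ ω, (3 * ‖batchMean G (fun i => Z i ω) T (2 ^ 0 * B) (x ω) - meanOp G π (x ω)‖ ^ 2 +
        3 * l ^ 2 * ‖batchMean G (fun i => Z i ω) T (2 ^ j * B) (x ω) - meanOp G π (x ω)‖ ^ 2 +
        3 * l ^ 2 * ‖batchMean G (fun i => Z i ω) T (2 ^ (j - 1) * B) (x ω) -
          meanOp G π (x ω)‖ ^ 2) ∂P :=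
        integral_mono_of_nonneg (ae_of_all _ fun ω => by positivity)
          ((((hint 0).const_mul _).add ((hint j).const_mul _)).add ((hint (j - 1)).const_mul _))
          (ae_of_all _ fun ω => norm_sub_randEstimate_sq_le _ _ _ _ _ _ _ _)
    _ ≤ 3 * (6 * τ / (2 ^ 0 * B) * s ^ 2) + 3 * l ^ 2 * (6 * τ / (2 ^ j * B) * s ^ 2) +
          3 * l ^ 2 * (6 * τ / (2 ^ (j - 1) * B) * s ^ 2) := by
        have h01 : Integrable (fun ω =>
            3 * ‖batchMean G (fun i => Z i ω) T (2 ^ 0 * B) (x ω) - meanOp G π (x ω)‖ ^ 2 +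
            3 * l ^ 2 * ‖batchMean G (fun i => Z i ω) T (2 ^ j * B) (x ω) -
              meanOp G π (x ω)‖ ^ 2) P :=
          ((hint 0).const_mul _).add ((hint j).const_mul _)
        rw [integral_add h01 ((hint (j - 1)).const_mul _), integral_add ((hint 0).const_mul _) ((hint j).const_mul _),
          integral_const_mul, integral_const_mul, integral_const_mul]
        have h0 := hb 0
        have h1 := hb j
        have h2 := hb (j - 1)
        gcongr
    _ ≤ 18 * τ / B * s ^ 2 * (1 + 3 * l) := by
        have e1 : 3 * l ^ 2 * (6 * τ / (2 ^ j * B) * s ^ 2) = 18 * τ / B * s ^ 2 * l := by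
          rw [hl, levelFactor_sq]
          field_simp
          ring
        have e2 : 3 * l ^ 2 * (6 * τ / (2 ^ (j - 1) * B) * s ^ 2) ≤
            18 * τ / B * s ^ 2 * (2 * l) := by
          have : l ^ 2 ≤ l * (2 * 2 ^ (j - 1)) := by
            rw [hl, levelFactor_sq]
            gcongr
          calc 3 * l ^ 2 * (6 * τ / (2 ^ (j - 1) * B) * s ^ 2) ≤
              3 * (l * (2 * 2 ^ (j - 1))) * (6 * τ / (2 ^ (j - 1) * B) * s ^ 2) := by gcongr
            _ = 18 * τ / B * s ^ 2 * (2 * l) := by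
              field_simp
              ring
        have e3 : 3 * (6 * τ / (2 ^ 0 * B) * s ^ 2) = 18 * τ / B * s ^ 2 := by
          rw [pow_zero, one_mul]
          ring
        linarith

/-- Each admissible level `i ≥ 1` contributes `2 ^ i * 2 ^ (-i) = 1`. -/
theorem IsIIDGeomHalf.integral_levelFactor_le (hJ : IsIIDGeomHalf P J)
    (hZ : ∀ n, Measurable (Z n)) (hZJ : IndepFun (fun ω n => Z n ω) (fun ω k => J k ω) P) (k : ℕ)
    {K : ℕ} (hK : ∀ l : ℕ, (2 : ℝ) ^ l ≤ M → l ≤ K) :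
    Integrable (fun ω => levelFactor M (J k ω)) P ∧
      ∫ ω, levelFactor M (J k ω) ∂P ≤ K + 1 := by
  have hm : Measurable fun ω => levelFactor M (J k ω) :=
    (measurable_from_top (f := levelFactor M)).comp (hJ.measurable k)
  have hi : ∀ i, Integrable (fun ω => if J k ω = i then (1 : ℝ) else 0) P := fun i => by
    refine Integrable.of_bound ((measurable_from_top (f := fun l : ℕ => if l = i then (1 : ℝ)
      else 0)).comp (hJ.measurable k)).aestronglyMeasurable 1 (ae_of_all _ fun ω => ?_)
    split_ifs <;> simp
  -- The leading `1` covers outcomes with `J k ω = 0`, which are null but not excluded pointwise.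
  have hle : ∀ ω, levelFactor M (J k ω) ≤
      1 + ∑ i ∈ Finset.Icc 1 K, 2 ^ i * (if J k ω = i then (1 : ℝ) else 0) := by
    intro ω
    have hnn : 0 ≤ ∑ i ∈ Finset.Icc 1 K, 2 ^ i * (if J k ω = i then (1 : ℝ) else 0) :=
      Finset.sum_nonneg fun i _ => by positivity
    unfold levelFactor
    split_ifs with h
    · have h1 := hK _ h
      rcases Nat.eq_zero_or_pos (J k ω) with h0 | h0
      · simp [h0]
      · have := Finset.single_le_sum (s := Finset.Icc 1 K)
          (f := fun i => 2 ^ i * (if J k ω = i then (1 : ℝ) else 0))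
          (fun i _ => by positivity) (Finset.mem_Icc.2 ⟨h0, h1⟩)
        simp only [if_true, mul_one] at this
        linarith
    · linarith
  have hint : Integrable (fun ω => 1 + ∑ i ∈ Finset.Icc 1 K,
      2 ^ i * (if J k ω = i then (1 : ℝ) else 0)) P :=
    (integrable_const _).add (integrable_finsetSum _ fun i _ => (hi i).const_mul _)
  have hl : Integrable (fun ω => levelFactor M (J k ω)) P :=
    hint.mono' hm.aestronglyMeasurable (ae_of_all _ fun ω => by
      rw [Real.norm_of_nonneg (levelFactor_nonneg _ _)]
      exact hle ω)
  refine ⟨hl, (integral_mono hl hint hle).trans ?_⟩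
  rw [integral_add (integrable_const _) (integrable_finsetSum _ fun i _ => (hi i).const_mul _),
    integral_finsetSum _ fun i _ => (hi i).const_mul _]
  have h1 : ∀ i ∈ Finset.Icc 1 K,
      ∫ ω, 2 ^ i * (if J k ω = i then (1 : ℝ) else 0) ∂P = 1 := by
    intro i hi
    rw [integral_const_mul]
    have := hJ.integral_ite_mul hZ hZJ k (Finset.mem_Icc.1 hi).1 (f := fun _ => 1) (c := 1)
      measurable_const (fun _ => by simp) (fun _ _ _ _ => rfl)
    simp only [mul_one, integral_const, probReal_univ, smul_eq_mul] at this
    rw [this, ← mul_pow]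
    norm_num
  rw [Finset.sum_congr rfl h1]
  simp [add_comm]

/-- The mean square error of the first batch of an iteration. -/
theorem integral_norm_batchErr_sq_le (hZ : IsStationaryMarkovChain P Z Q π)
    (hQ : HasMixingTime Q τ) (hJ : IsIIDGeomHalf P J)
    (hZJ : IndepFun (fun ω n => Z n ω) (fun ω k => J k ω) P)
    (hG : Measurable (Function.uncurry G)) (hs : ∀ x ∈ X, ∀ z, ‖G x z - meanOp G π x‖ ≤ s)
    (hp : Measurable (prox X r γ)) (hX : IsCompact X) (hr : LowerSemicontinuousOn r X)
    (hγ : 0 < γ) (hx₀ : x₀ ∈ X) (hB : 1 ≤ B) (k : ℕ) :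
    ∫ ω, ‖batchErr (meanOp G π) G r X γ B M x₀ (fun i => Z i ω) (fun k => J k ω) k‖ ^ 2 ∂P ≤
      6 * τ / B * s ^ 2 := by
  have hZm : Measurable fun ω n => Z n ω := measurable_pi_lambda _ hZ.measurable
  have hJm : Measurable fun ω k => J k ω := measurable_pi_lambda _ hJ.measurable
  -- Integrating over the chain first, with the levels frozen, makes the sample counter a
  -- deterministic time.
  have h1 := integral_eq_of_indepFun hZm hJm hZJ (c := s ^ 2)
    (f := fun p => ‖batchErr (meanOp G π) G r X γ B M x₀ p.1 p.2 k‖ ^ 2)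
    ((measurable_batchErr (Z := fun i (p : (ℕ → S) × (ℕ → ℕ)) => p.1 i) (J := fun i p => p.2 i)
      (measurable_meanOp hG π) hp hG (fun i => (measurable_pi_apply i).comp measurable_fst)
      (fun i => (measurable_pi_apply i).comp measurable_snd) k).norm.pow_const 2)
    (fun p => by
      rw [abs_of_nonneg (by positivity)]
      exact pow_le_pow_left₀ (norm_nonneg _) (norm_batchMean_sub_le
        (hs _ (state_fst_mem hX hr hγ hx₀ p.1 p.2 k)) _ _ hB) 2)
  rw [h1]
  refine (integral_mono_of_nonneg (g := fun _ => 6 * τ / B * s ^ 2)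
    (ae_of_all _ fun _ => integral_nonneg fun _ => by positivity)
    (integrable_const _) (ae_of_all _ fun ω' => ?_)).trans (by simp)
  simp only [batchErr, state_snd]
  exact hZ.integral_norm_batchMean_sub_sq_le hQ hG hs _ hB
    (measurable_past_state_fst hp hG Z _ k) fun ω => state_fst_mem hX hr hγ hx₀ _ _ k

/-- The mean square error of the randomized estimate. -/
theorem integral_norm_estErr_sq_le (hZ : IsStationaryMarkovChain P Z Q π)
    (hQ : HasMixingTime Q τ) (hJ : IsIIDGeomHalf P J)
    (hZJ : IndepFun (fun ω n => Z n ω) (fun ω k => J k ω) P)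
    (hG : Measurable (Function.uncurry G)) (hs : ∀ x ∈ X, ∀ z, ‖G x z - meanOp G π x‖ ≤ s)
    (hp : Measurable (prox X r γ)) (hX : IsCompact X) (hr : LowerSemicontinuousOn r X)
    (hγ : 0 < γ) (hx₀ : x₀ ∈ X) (hB : 1 ≤ B) (hM : 0 ≤ M) {K : ℕ}
    (hK : ∀ l : ℕ, (2 : ℝ) ^ l ≤ M → l ≤ K) (k : ℕ) :
    ∫ ω, ‖estErr (meanOp G π) G r X γ B M x₀ (fun i => Z i ω) (fun k => J k ω) k‖ ^ 2 ∂P ≤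
      18 * τ / B * s ^ 2 * (1 + 3 * (K + 1)) := by
  have hZm : Measurable fun ω n => Z n ω := measurable_pi_lambda _ hZ.measurable
  have hJm : Measurable fun ω k => J k ω := measurable_pi_lambda _ hJ.measurable
  have hhX : ∀ z j, halfIterate G r X γ B M x₀ z j k ∈ X := fun z j =>
    (isProx_halfIterate hX hr hγ hx₀ z j k).1
  have h1 := integral_eq_of_indepFun hZm hJm hZJ (c := (s + M * (s + s)) ^ 2)
    (f := fun p => ‖estErr (meanOp G π) G r X γ B M x₀ p.1 p.2 k‖ ^ 2)
    ((measurable_estErr (Z := fun i (p : (ℕ → S) × (ℕ → ℕ)) => p.1 i) (J := fun i p => p.2 i)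
      (measurable_meanOp hG π) hp hG (fun i => (measurable_pi_apply i).comp measurable_fst)
      (fun i => (measurable_pi_apply i).comp measurable_snd) k).norm.pow_const 2)
    (fun p => by
      rw [abs_of_nonneg (by positivity)]
      exact pow_le_pow_left₀ (norm_nonneg _) (norm_sub_randEstimate_le
        (hs _ (hhX p.1 p.2)) _ _ hB hM _) 2)
  rw [h1]
  obtain ⟨hl, hle⟩ := hJ.integral_levelFactor_le hZ.measurable hZJ k hK
  have hint : Integrable (fun ω => 1 + 3 * levelFactor M (J k ω)) P :=
    (integrable_const _).add (hl.const_mul _)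
  refine (integral_mono_of_nonneg
    (g := fun ω => 18 * τ / B * s ^ 2 * (1 + 3 * levelFactor M (J k ω)))
    (ae_of_all _ fun _ => integral_nonneg fun _ => by positivity)
    (hint.const_mul _) (ae_of_all _ fun ω' => ?_)).trans ?_
  · simp only [estErr, state_snd]
    exact hZ.integral_norm_sub_randEstimate_sq_le hQ hG hs _ hB M _
      (measurable_past_halfIterate hp hG Z _ k) fun ω => hhX _ _
  · rw [integral_const_mul, integral_add (integrable_const _) (hl.const_mul _),
      integral_const_mul]
    simp only [integral_const, probReal_univ, smul_eq_mul, mul_one]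
    gcongr

/-- The correlation of the error of the `i`-th batch average at `x^{k+1/2}` with the difference of
`x^{k+1/2}` and the auxiliary sequence. -/
def batchCorr (m : E → E) (G : E → S → E) (r : E → ℝ) (X : Set E) (γ : ℝ) (B : ℕ) (M : ℝ) (x₀ : E)
    (k i : ℕ) (p : (ℕ → S) × (ℕ → ℕ)) : ℝ :=
  ⟪halfIterate G r X γ B M x₀ p.1 p.2 k - ghost m G r X γ B M x₀ p.1 p.2 k,
    batchMean G p.1 (clock B p.2 k + B) (2 ^ i * B) (halfIterate G r X γ B M x₀ p.1 p.2 k) -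
      m (halfIterate G r X γ B M x₀ p.1 p.2 k)⟫

/-- Expanding over the values of `j k` separates the indicator of a level from quantities that
depend on earlier levels and the chain, so that independence can be applied term by term. -/
theorem inner_estErr_eq {E S : Type*} [NormedAddCommGroup E] [InnerProductSpace ℝ E]
    {m : E → E} {G : E → S → E} {r : E → ℝ} {X : Set E} {γ : ℝ} {B : ℕ}
    {M : ℝ} {x₀ : E} {K : ℕ} (hK : ∀ l : ℕ, (2 : ℝ) ^ l ≤ M ↔ l ≤ K) (z : ℕ → S) (j : ℕ → ℕ)
    (k : ℕ) :
    ⟪estErr m G r X γ B M x₀ z j k,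
      halfIterate G r X γ B M x₀ z j k - ghost m G r X γ B M x₀ z j k⟫ =
    -(batchCorr m G r X γ B M x₀ k 0 (z, j) + ∑ i ∈ Finset.Icc 1 K, 2 ^ i *
      ((if j k = i then 1 else 0) * (batchCorr m G r X γ B M x₀ k i (z, j) -
        batchCorr m G r X γ B M x₀ k (i - 1) (z, j)))) := by
  set h := halfIterate G r X γ B M x₀ z j k with hh
  set w := h - ghost m G r X γ B M x₀ z j k with hw
  have hc : ∀ i, batchCorr m G r X γ B M x₀ k i (z, j) =
      ⟪w, batchMean G z (clock B j k + B) (2 ^ i * B) h - m h⟫ := fun i => rfl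
  have hsub : ∀ i i', batchCorr m G r X γ B M x₀ k i (z, j) -
      batchCorr m G r X γ B M x₀ k i' (z, j) =
      ⟪w, batchMean G z (clock B j k + B) (2 ^ i * B) h -
        batchMean G z (clock B j k + B) (2 ^ i' * B) h⟫ := fun i i' => by
    rw [hc, hc, ← inner_sub_right, sub_sub_sub_cancel_right]
  have hsum : ∑ i ∈ Finset.Icc 1 K, 2 ^ i *
      ((if j k = i then 1 else 0) * (batchCorr m G r X γ B M x₀ k i (z, j) -
        batchCorr m G r X γ B M x₀ k (i - 1) (z, j))) =
      levelFactor M (j k) * (batchCorr m G r X γ B M x₀ k (j k) (z, j) -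
        batchCorr m G r X γ B M x₀ k (j k - 1) (z, j)) := by
    unfold levelFactor
    simp only [ite_mul, one_mul, zero_mul, mul_ite, mul_zero, hK, Finset.sum_ite_eq,
      Finset.mem_Icc]
    -- At `j k = 0` both sides vanish, since `0 - 1 = 0` makes the two batches coincide.
    rcases Nat.eq_zero_or_pos (j k) with h0 | h0
    · simp [h0]
    · simp [Nat.succ_le_iff, h0]
  rw [hsum, hsub, hc, ← inner_smul_right, ← inner_add_right, ← inner_neg_right, real_inner_comm]
  congr 1
  rw [estErr, ← hh, state_snd, randEstimate_eq]
  abel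

theorem batchCorr_congr {E S : Type*} [NormedAddCommGroup E] [InnerProductSpace ℝ E]
    {m : E → E} {G : E → S → E} {r : E → ℝ} {X : Set E} {γ : ℝ} {B : ℕ}
    {M : ℝ} {x₀ : E} {k i : ℕ} (z : ℕ → S) {j j' : ℕ → ℕ} (hj : ∀ l < k, j l = j' l) :
    batchCorr m G r X γ B M x₀ k i (z, j) = batchCorr m G r X γ B M x₀ k i (z, j') := by
  unfold batchCorr
  rw [halfIterate_congr (fun _ _ => rfl) hj, ghost_congr (fun _ _ => rfl) hj, clock_congr hj]

/-- The bias of the randomized estimate. -/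
theorem abs_integral_inner_estErr_le (hZ : IsStationaryMarkovChain P Z Q π)
    (hQ : HasMixingTime Q τ) (hJ : IsIIDGeomHalf P J)
    (hZJ : IndepFun (fun ω n => Z n ω) (fun ω k => J k ω) P)
    (hG : Measurable (Function.uncurry G)) (hs : ∀ x ∈ X, ∀ z, ‖G x z - meanOp G π x‖ ≤ s)
    (hp : Measurable (prox X r γ)) (hp₀ : Measurable (prox X (fun _ => 0) 1))
    (hX : IsCompact X) (hr : LowerSemicontinuousOn r X)
    {b : ℝ} (hb : ∀ x ∈ X, ∀ y ∈ X, ‖x - y‖ ≤ b)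
    (hγ : 0 < γ) (hx₀ : x₀ ∈ X) (hB : 1 ≤ B) {K : ℕ}
    (hK : ∀ l : ℕ, (2 : ℝ) ^ l ≤ M ↔ l ≤ K) (k : ℕ) :
    |∫ ω, ⟪estErr (meanOp G π) G r X γ B M x₀ (fun i => Z i ω) (fun k => J k ω) k,
      halfIterate G r X γ B M x₀ (fun i => Z i ω) (fun k => J k ω) k -
        ghost (meanOp G π) G r X γ B M x₀ (fun i => Z i ω) (fun k => J k ω) k⟫ ∂P| ≤
      3 * τ / (2 ^ K * B) * (b * s) := by
  have hZm : Measurable fun ω n => Z n ω := measurable_pi_lambda _ hZ.measurable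
  have hJm : Measurable fun ω k => J k ω := measurable_pi_lambda _ hJ.measurable
  have hmm := measurable_meanOp hG π
  have hn : ∀ i, 1 ≤ 2 ^ i * B := fun i => Nat.mul_pos (by positivity) hB
  have hhX : ∀ z j, halfIterate G r X γ B M x₀ z j k ∈ X := fun z j =>
    (isProx_halfIterate hX hr hγ hx₀ z j k).1
  have hwb : ∀ z j, ‖halfIterate G r X γ B M x₀ z j k -
      ghost (meanOp G π) G r X γ B M x₀ z j k‖ ≤ b := fun z j =>
    hb _ (hhX z j) _ (ghost_mem hX hx₀ z j k)
  set f : ℕ → (ℕ → S) × (ℕ → ℕ) → ℝ := batchCorr (meanOp G π) G r X γ B M x₀ k with hf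
  have hfm : ∀ i, Measurable (f i) := fun i => by
    have h1 : ∀ i, Measurable fun p : (ℕ → S) × (ℕ → ℕ) => p.1 i :=
      fun i => (measurable_pi_apply i).comp measurable_fst
    have h2 : ∀ i, Measurable fun p : (ℕ → S) × (ℕ → ℕ) => p.2 i :=
      fun i => (measurable_pi_apply i).comp measurable_snd
    have h3 := measurable_halfIterate (B := B) (M := M) (x₀ := x₀) hp hG h1 h2 k
    have h4 := measurable_ghost (B := B) (M := M) (x₀ := x₀) hmm hp hp₀ hG h1 h2 k
    have h5 : Measurable fun p : (ℕ → S) × (ℕ → ℕ) => clock B p.2 k := by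
      have := (measurable_state (B := B) (M := M) (x₀ := x₀) hp hG h1 h2 k).snd
      simpa only [state_snd] using this
    exact (h3.sub h4).inner ((measurable_batchMean hG h1 (h5.add_const B) _ h3).sub (hmm.comp h3))
  have hfb : ∀ i p, |f i p| ≤ b * s := fun i p => by
    refine (abs_real_inner_le_norm _ _).trans ?_
    exact mul_le_mul (hwb _ _) (norm_batchMean_sub_le (hs _ (hhX _ _)) _ _ (hn i)) (norm_nonneg _)
      ((norm_nonneg _).trans (hwb p.1 p.2))
  have hZJm : Measurable fun ω => ((fun n => Z n ω : ℕ → S), (fun k => J k ω : ℕ → ℕ)) :=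
    hZm.prodMk hJm
  have hfi : ∀ i, Integrable (fun ω => f i (fun n => Z n ω, fun k => J k ω)) P := fun i =>
    Integrable.of_bound ((hfm i).comp hZJm).aestronglyMeasurable (b * s)
      (ae_of_all _ fun ω => hfb i _)
  -- The weight `2 ^ i` cancels the probability of level `i`; `batchCorr_congr` supplies the
  -- dependence on earlier levels alone.
  have hterm : ∀ i ∈ Finset.Icc 1 K, Integrable (fun ω => 2 ^ i * ((if J k ω = i then 1 else 0) *
      (f i (fun n => Z n ω, fun k => J k ω) - f (i - 1) (fun n => Z n ω, fun k => J k ω)))) P ∧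
      ∫ ω, 2 ^ i * ((if J k ω = i then 1 else 0) *
        (f i (fun n => Z n ω, fun k => J k ω) - f (i - 1) (fun n => Z n ω, fun k => J k ω))) ∂P =
      ∫ ω, f i (fun n => Z n ω, fun k => J k ω) ∂P -
        ∫ ω, f (i - 1) (fun n => Z n ω, fun k => J k ω) ∂P := by
    intro i hi
    constructor
    · refine Integrable.const_mul (((hfi i).sub (hfi (i - 1))).bdd_mul (c := 1)
        ((measurable_from_top (f := fun l : ℕ => if l = i then (1 : ℝ) else 0)).comp
          (hJ.measurable k)).aestronglyMeasurable (ae_of_all _ fun ω => ?_)) _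
      simp only [Function.comp_apply]
      split_ifs <;> simp
    · rw [integral_const_mul]
      have h1 := hJ.integral_ite_mul hZ.measurable hZJ k (Finset.mem_Icc.1 hi).1
        (f := fun p => f i p - f (i - 1) p) (c := b * s + b * s) ((hfm i).sub (hfm (i - 1)))
        (fun p => (abs_sub _ _).trans (add_le_add (hfb _ _) (hfb _ _)))
        (fun z j j' hj => by simp only [hf, batchCorr_congr z hj])
      rw [h1, ← mul_assoc, ← mul_pow, integral_sub (hfi i) (hfi (i - 1))]
      norm_num
  have htel : ∀ (a : ℕ → ℝ) (n : ℕ), ∑ i ∈ Finset.Icc 1 n, (a i - a (i - 1)) = a n - a 0 := by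
    intro a n
    induction n with
    | zero => simp
    | succ n ih =>
      rw [Finset.sum_Icc_succ_top (by omega), ih, Nat.add_sub_cancel]
      ring
  -- The level differences telescope, and the `g_0` term cancels the lower end, so that only the
  -- batch of length `2 ^ K * B` is left.
  have hmain : ∫ ω, ⟪estErr (meanOp G π) G r X γ B M x₀ (fun i => Z i ω) (fun k => J k ω) k,
      halfIterate G r X γ B M x₀ (fun i => Z i ω) (fun k => J k ω) k -
        ghost (meanOp G π) G r X γ B M x₀ (fun i => Z i ω) (fun k => J k ω) k⟫ ∂P =
      -∫ ω, f K (fun n => Z n ω, fun k => J k ω) ∂P := by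
    simp_rw [inner_estErr_eq hK]
    rw [integral_neg, integral_add (hfi 0) (integrable_finsetSum _ fun i hi => (hterm i hi).1),
      integral_finsetSum _ fun i hi => (hterm i hi).1,
      Finset.sum_congr rfl fun i hi => (hterm i hi).2,
      htel (fun i => ∫ ω, f i (fun n => Z n ω, fun k => J k ω) ∂P)]
    ring
  rw [hmain, abs_neg, integral_eq_of_indepFun hZm hJm hZJ (hfm K) (hfb K)]
  have h4 := norm_integral_le_of_norm_le_const (μ := P)
    (f := fun ω' => ∫ ω, f K (fun n => Z n ω, fun k => J k ω') ∂P)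
    (C := 3 * τ / (2 ^ K * B) * (b * s)) (ae_of_all _ fun ω' => ?_)
  · simpa using h4
  · have h5 := hZ.abs_integral_inner_batchMean_sub_le hQ hG hs (clock B (fun k => J k ω') k + B)
      (hn K) (measurable_past_halfIterate (M := M) (x₀ := x₀) hp hG Z (fun k => J k ω') k)
      ((measurable_past_halfIterate (M := M) (x₀ := x₀) hp hG Z (fun k => J k ω') k).sub
        (measurable_past_ghost hmm hp hp₀ hG Z (fun k => J k ω') k))
      (fun ω => hhX _ _) (fun ω => hwb _ _)
    rw [Nat.cast_mul, Nat.cast_pow, Nat.cast_ofNat] at h5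
    exact h5

end ErrorBounds

/-! ### The expected gap -/

section ExpectedGap

theorem two_mul_le_div_add_mul {γ : ℝ} (hγ : 0 < γ) (a b : ℝ) :
    2 * (a * b) ≤ a ^ 2 / γ + γ * b ^ 2 := by
  have h : a ^ 2 / γ + γ * b ^ 2 - 2 * (a * b) = (a - γ * b) ^ 2 / γ := by
    field_simp
    ring
  have : 0 ≤ (a - γ * b) ^ 2 / γ := by positivity
  linarith

/-- `K` is the largest level with `2 ^ K ≤ √N`. Its lower bound controls the bias, and its upper
bound, from `√N ≤ N`, the number of levels. -/
theorem exists_level_bound {N : ℕ} (hN : 2 ≤ N) :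
    ∃ K : ℕ, (∀ l : ℕ, (2 : ℝ) ^ l ≤ Real.sqrt N ↔ l ≤ K) ∧ Real.sqrt N ≤ 2 * 2 ^ K ∧
      (K : ℝ) ≤ Real.logb 2 N := by
  have hN' : (1 : ℝ) ≤ N := by exact_mod_cast (by omega : 1 ≤ N)
  obtain ⟨K, h1, h2⟩ := exists_nat_pow_near (Real.one_le_sqrt.2 hN') (one_lt_two : (1 : ℝ) < 2)
  refine ⟨K, fun l => ⟨fun h => ?_, fun h => ?_⟩, ?_, ?_⟩
  · exact Nat.lt_succ_iff.1 ((pow_lt_pow_iff_right₀ one_lt_two).1 (h.trans_lt h2))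
  · exact (pow_le_pow_right₀ one_le_two h).trans h1
  · rw [← pow_succ']
    exact h2.le
  · rw [Real.le_logb_iff_rpow_le one_lt_two (by linarith), Real.rpow_natCast]
    exact h1.trans (Real.sqrt_le_iff.2 ⟨by linarith, by nlinarith⟩)

variable {E S Ω : Type*} [NormedAddCommGroup E] [InnerProductSpace ℝ E] [FiniteDimensional ℝ E]
  [MeasurableSpace E] [BorelSpace E] [MeasurableSpace S] [MeasurableSpace Ω]
  {P : Measure Ω} [IsProbabilityMeasure P] {Z : ℕ → Ω → S} {Q : Kernel S S}
  [IsMarkovKernel Q] {π : Measure S} [IsProbabilityMeasure π] {τ : ℕ} {G : E → S → E} {X : Set E}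
  {F : E → E} {s L D : ℝ} {J : ℕ → Ω → ℕ} {r : E → ℝ} {γ : ℝ} {B N : ℕ} {x₀ : E}

/-- The gap is measurable by semicontinuity and lies between `0` and the integrable bound along
realizations, whose expectation is then estimated term by term. -/
theorem integral_gap_averagedIterate_le (hX : IsCompact X)
    (hXD : ∀ x ∈ X, ∀ y ∈ X, ‖x - y‖ ^ 2 ≤ D ^ 2) (hL : 0 < L)
    (hF : ∀ x ∈ X, ∀ y ∈ X, ‖F x - F y‖ ≤ L * ‖x - y‖)
    (hmono : ∀ x ∈ X, ∀ y ∈ X, 0 ≤ ⟪F x - F y, x - y⟫) (hc : ConvexOn ℝ X r)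
    (hr : LowerSemicontinuousOn r X) (hQ : HasMixingTime Q τ)
    (hZ : IsStationaryMarkovChain P Z Q π) (hJ : IsIIDGeomHalf P J)
    (hZJ : IndepFun (fun ω n => Z n ω) (fun ω k => J k ω) P)
    (hG : Measurable (Function.uncurry G)) (hm : ∀ x ∈ X, meanOp G π x = F x)
    (hs : ∀ x ∈ X, ∀ z, ‖G x z - meanOp G π x‖ ≤ s) (hx₀ : x₀ ∈ X) (hγ : 0 < γ)
    (hγL : γ ≤ 1 / 2 / L) (hB : 1 ≤ B) (hN : 2 ≤ N) :
    Integrable (fun ω => gap F r X (averagedIterate G r X γ B (Real.sqrt N) x₀ (fun n => Z n ω)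
      (fun k => J k ω) N)) P ∧
    ∫ ω, gap F r X (averagedIterate G r X γ B (Real.sqrt N) x₀ (fun n => Z n ω)
      (fun k => J k ω) N) ∂P ≤
      261 * (D ^ 2 / (γ * N) + γ * (τ / B * Real.logb 2 N + (τ : ℝ) ^ 2 / (B : ℝ) ^ 2) * s ^ 2) := by
  obtain ⟨K, hK, hK2, hKl⟩ := exists_level_bound hN
  set M := Real.sqrt N with hM
  have hM0 : 0 ≤ M := Real.sqrt_nonneg _
  have hne : X.Nonempty := ⟨x₀, hx₀⟩
  have hp : Measurable (prox X r γ) := (continuous_prox hX hne hc hr hγ).measurable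
  have hp₀ : Measurable (prox X (fun _ => 0) 1) :=
    (continuous_prox hX hne (convexOn_const 0 hc.1) continuousOn_const.lowerSemicontinuousOn
      one_pos).measurable
  have hmm := measurable_meanOp hG π
  have hb : ∀ x ∈ X, ∀ y ∈ X, ‖x - y‖ ≤ |D| := fun x hx y hy =>
    abs_norm (x - y) ▸ sq_le_sq.1 (hXD x hx y hy)
  have hN1 : 1 ≤ N := by omega
  have hN' : (0 : ℝ) < N := by positivity
  have hbdd : ∀ x, BddAbove (gapSet F r X x) := bddAbove_gapSet hX hF hr
  set h : ℕ → Ω → E := fun k ω =>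
    halfIterate G r X γ B M x₀ (fun n => Z n ω) (fun k => J k ω) k with hh
  set u : ℕ → Ω → E := fun k ω =>
    ghost (meanOp G π) G r X γ B M x₀ (fun n => Z n ω) (fun k => J k ω) k with hu
  set a : ℕ → Ω → E := fun k ω =>
    batchErr (meanOp G π) G r X γ B M x₀ (fun n => Z n ω) (fun k => J k ω) k with ha
  set e : ℕ → Ω → E := fun k ω =>
    estErr (meanOp G π) G r X γ B M x₀ (fun n => Z n ω) (fun k => J k ω) k with he
  have hhm : ∀ k, Measurable (h k) := fun k =>
    measurable_halfIterate hp hG hZ.measurable hJ.measurable k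
  have hum : ∀ k, Measurable (u k) := fun k =>
    measurable_ghost hmm hp hp₀ hG hZ.measurable hJ.measurable k
  have ham : ∀ k, Measurable (a k) := fun k =>
    measurable_batchErr hmm hp hG hZ.measurable hJ.measurable k
  have hem : ∀ k, Measurable (e k) := fun k =>
    measurable_estErr hmm hp hG hZ.measurable hJ.measurable k
  have hhX : ∀ k ω, h k ω ∈ X := fun k ω => (isProx_halfIterate hX hr hγ hx₀ _ _ k).1
  have has : ∀ k ω, ‖a k ω‖ ≤ s := fun k ω =>
    norm_batchMean_sub_le (hs _ (state_fst_mem hX hr hγ hx₀ _ _ k)) _ _ hB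
  have hes : ∀ k ω, ‖e k ω‖ ≤ s + M * (s + s) := fun k ω =>
    norm_sub_randEstimate_le (hs _ (hhX k ω)) _ _ hB hM0 _
  have hai : ∀ k, Integrable (fun ω => ‖a k ω‖ ^ 2) P := fun k => by
    refine Integrable.of_bound ((ham k).norm.pow_const 2).aestronglyMeasurable (s ^ 2)
      (ae_of_all _ fun ω => ?_)
    rw [Real.norm_of_nonneg (by positivity)]
    exact pow_le_pow_left₀ (norm_nonneg _) (has k ω) 2
  have hei : ∀ k, Integrable (fun ω => ‖e k ω‖ ^ 2) P := fun k => by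
    refine Integrable.of_bound ((hem k).norm.pow_const 2).aestronglyMeasurable
      ((s + M * (s + s)) ^ 2) (ae_of_all _ fun ω => ?_)
    rw [Real.norm_of_nonneg (by positivity)]
    exact pow_le_pow_left₀ (norm_nonneg _) (hes k ω) 2
  have hci : ∀ k, Integrable (fun ω => ⟪e k ω, h k ω - u k ω⟫) P := fun k => by
    refine Integrable.of_bound ((hem k).inner ((hhm k).sub (hum k))).aestronglyMeasurable
      ((s + M * (s + s)) * |D|) (ae_of_all _ fun ω => (norm_inner_le_norm _ _).trans ?_)
    exact mul_le_mul (hes k ω) (hb _ (hhX k ω) _ (ghost_mem hX hx₀ _ _ k)) (norm_nonneg _)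
      ((norm_nonneg _).trans (hes k ω))
  have h12 : ∀ k, Integrable (fun ω => 3 * γ ^ 2 / 2 * ‖a k ω‖ ^ 2 + 2 * γ ^ 2 * ‖e k ω‖ ^ 2) P :=
    fun k => ((hai k).const_mul _).add ((hei k).const_mul _)
  have h123 : ∀ k, Integrable (fun ω => 3 * γ ^ 2 / 2 * ‖a k ω‖ ^ 2 + 2 * γ ^ 2 * ‖e k ω‖ ^ 2 +
      γ * ⟪e k ω, h k ω - u k ω⟫) P := fun k => (h12 k).add ((hci k).const_mul _)
  have hsumi : Integrable (fun ω => ∑ k ∈ Finset.range N, (3 * γ ^ 2 / 2 * ‖a k ω‖ ^ 2 +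
      2 * γ ^ 2 * ‖e k ω‖ ^ 2 + γ * ⟪e k ω, h k ω - u k ω⟫)) P :=
    integrable_finsetSum _ fun k _ => h123 k
  have hbi : Integrable (fun ω => (γ * N)⁻¹ * (D ^ 2 + ∑ k ∈ Finset.range N,
      (3 * γ ^ 2 / 2 * ‖a k ω‖ ^ 2 + 2 * γ ^ 2 * ‖e k ω‖ ^ 2 +
        γ * ⟪e k ω, h k ω - u k ω⟫))) P :=
    ((integrable_const _).add hsumi).const_mul _
  set x : Ω → E := fun ω =>
    averagedIterate G r X γ B M x₀ (fun n => Z n ω) (fun k => J k ω) N with hx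
  have hxX : ∀ ω, x ω ∈ X := fun ω => averagedIterate_mem hX hc.1 hr hγ hx₀ _ _ hN1
  have hxm : Measurable x :=
    (Finset.measurable_fun_sum _ fun k _ => hhm k).const_smul (N : ℝ)⁻¹
  have hpath : ∀ ω, gap F r X (x ω) ≤ (γ * N)⁻¹ * (D ^ 2 + ∑ k ∈ Finset.range N,
      (3 * γ ^ 2 / 2 * ‖a k ω‖ ^ 2 + 2 * γ ^ 2 * ‖e k ω‖ ^ 2 +
        γ * ⟪e k ω, h k ω - u k ω⟫)) := fun ω =>
    gap_averagedIterate_le hX hXD hL hF hmono hc hr hm hx₀ hγ hγL hN1 _ _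
  have hgi : Integrable (fun ω => gap F r X (x ω)) P :=
    hbi.mono' (measurable_comp_of_lowerSemicontinuousOn
      (lowerSemicontinuousOn_gap hne hbdd hr) hxm hxX).aestronglyMeasurable
      (ae_of_all _ fun ω => by
        rw [Real.norm_of_nonneg (gap_nonneg (hxX ω) (hbdd _))]
        exact hpath ω)
  refine ⟨hgi, (integral_mono hgi hbi hpath).trans ?_⟩
  set W := 3 * τ / (2 ^ K * B) * (|D| * s) with hW
  have hk : ∀ k, ∫ ω, (3 * γ ^ 2 / 2 * ‖a k ω‖ ^ 2 + 2 * γ ^ 2 * ‖e k ω‖ ^ 2 +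
      γ * ⟪e k ω, h k ω - u k ω⟫) ∂P ≤ 3 * γ ^ 2 / 2 * (6 * τ / B * s ^ 2) +
        2 * γ ^ 2 * (18 * τ / B * s ^ 2 * (1 + 3 * (K + 1))) + γ * W := by
    intro k
    rw [integral_add (h12 k) ((hci k).const_mul _),
      integral_add ((hai k).const_mul _) ((hei k).const_mul _), integral_const_mul,
      integral_const_mul, integral_const_mul]
    have b1 := integral_norm_batchErr_sq_le (M := M) hZ hQ hJ hZJ hG hs hp hX hr hγ hx₀ hB k
    have b2 := integral_norm_estErr_sq_le hZ hQ hJ hZJ hG hs hp hX hr hγ hx₀ hB hM0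
      (fun l => (hK l).1) k
    have b3 := (le_abs_self _).trans
      (abs_integral_inner_estErr_le hZ hQ hJ hZJ hG hs hp hp₀ hX hr hb hγ hx₀ hB hK k)
    gcongr
  rw [integral_const_mul, integral_add (integrable_const _) hsumi,
    integral_finsetSum _ fun k _ => h123 k]
  simp only [integral_const, probReal_univ, smul_eq_mul, one_mul]
  have hsum := Finset.sum_le_sum fun k (_ : k ∈ Finset.range N) => hk k
  rw [Finset.sum_const, Finset.card_range, nsmul_eq_mul] at hsum
  have hs0 : 0 ≤ s := by
    obtain ⟨ω⟩ : Nonempty Ω := nonempty_of_isProbabilityMeasure P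
    exact (norm_nonneg _).trans (hs x₀ hx₀ (Z 0 ω))
  have hB' : (0 : ℝ) < B := by positivity
  set ℓ := Real.logb 2 N with hℓ
  have hℓ1 : 1 ≤ ℓ := by
    rw [hℓ, Real.le_logb_iff_rpow_le one_lt_two hN', Real.rpow_one]
    exact_mod_cast hN
  have hMpos : 0 < M := Real.sqrt_pos.2 hN'
  have hMsq : M ^ 2 = N := Real.sq_sqrt hN'.le
  -- From `2 ^ K ≥ √N / 2`, followed by Young's inequality for `|D| / √N` and `τ s / B` with weight
  -- `γ`.
  have hW1 : W ≤ 3 * (D ^ 2 / (γ * N) + γ * (τ ^ 2 / B ^ 2) * s ^ 2) := by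
    have h1 : W ≤ 3 * (2 * (|D| / M * (τ * s / B))) := by
      rw [hW]
      calc 3 * τ / (2 ^ K * B) * (|D| * s) ≤ 3 * τ / (M / 2 * B) * (|D| * s) := by
            gcongr
            linarith
        _ = 3 * (2 * (|D| / M * (τ * s / B))) := by
            field_simp
    have h2 := two_mul_le_div_add_mul hγ (|D| / M) (τ * s / B)
    have h3 : (|D| / M) ^ 2 / γ = D ^ 2 / (γ * N) := by
      rw [div_pow, sq_abs, hMsq, div_div, mul_comm]
    have h4 : γ * (τ * s / B) ^ 2 = γ * (τ ^ 2 / B ^ 2) * s ^ 2 := by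
      rw [div_pow, mul_pow]
      ring
    linarith
  have hA : γ * (τ / B * s ^ 2) ≤ γ * (τ / B * s ^ 2) * ℓ :=
    le_mul_of_one_le_right (by positivity) hℓ1
  have hA' : γ * (τ / B * s ^ 2) * K ≤ γ * (τ / B * s ^ 2) * ℓ := by gcongr
  have hD : 0 ≤ D ^ 2 / (γ * N) := by positivity
  have hT : 0 ≤ γ * (τ ^ 2 / B ^ 2) * s ^ 2 := by positivity
  calc _ ≤ (γ * N)⁻¹ * (D ^ 2 + N * (3 * γ ^ 2 / 2 * (6 * τ / B * s ^ 2) +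
        2 * γ ^ 2 * (18 * τ / B * s ^ 2 * (1 + 3 * (K + 1))) + γ * W)) := by gcongr
    -- `3/2 * 6 = 9` from the first batch and `36 * (4 + 3K) = 144 + 108K` from the randomized
    -- estimate. Since `1` and `K` are both at most `ℓ`, the total is `153 + 108 = 261`.
    _ = D ^ 2 / (γ * N) + 153 * (γ * (τ / B * s ^ 2)) + 108 * (γ * (τ / B * s ^ 2) * K) + W := by
        field_simp
        ring
    _ ≤ D ^ 2 / (γ * N) + 261 * (γ * (τ / B * s ^ 2) * ℓ) + W := by linarith
    _ ≤ 261 * (D ^ 2 / (γ * N) + (γ * (τ / B * s ^ 2) * ℓ + γ * (τ ^ 2 / B ^ 2) * s ^ 2)) := by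
        linarith
    _ = _ := by ring

end ExpectedGap

end RandEG

end

/-! ### The theorem with explicit absolute constants. -/

theorem mainTheorem10 :
    ∃ c C : ℝ, 0 < c ∧ 0 < C ∧
      ∀ (d : ℕ)
        (S : Type*) [TopologicalSpace S] [PolishSpace S] [MeasurableSpace S] [BorelSpace S]
        (Ω : Type*) [MeasurableSpace Ω] (P : Measure Ω) [IsProbabilityMeasure P]
        -- the problem: feasible set, operator, regularizer, a solution
        (X : Set (EuclideanSpace ℝ (Fin d)))
        (F : EuclideanSpace ℝ (Fin d) → EuclideanSpace ℝ (Fin d))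
        (r : EuclideanSpace ℝ (Fin d) → ℝ)
        (xstar : EuclideanSpace ℝ (Fin d))
        (L D : ℝ),
        Convex ℝ X → IsClosed X → (∀ x ∈ X, ∀ y ∈ X, ‖x - y‖ ^ 2 ≤ D ^ 2) →
        0 < L → (∀ x ∈ X, ∀ y ∈ X, ‖F x - F y‖ ≤ L * ‖x - y‖) →
        (∀ x ∈ X, ∀ y ∈ X, 0 ≤ ⟪F x - F y, x - y⟫) →
        ConvexOn ℝ X r → LowerSemicontinuousOn r X →
        RandEG.IsVISolution F r X xstar →
        -- the noise: a stationary, uniformly geometrically ergodic Markov chain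
        ∀ (Q : Kernel S S) [IsMarkovKernel Q] (π : Measure S) [IsProbabilityMeasure π] (τ : ℕ)
          (Z : ℕ → Ω → S) (J : ℕ → Ω → ℕ),
        RandEG.HasMixingTime Q τ →
        RandEG.IsStationaryMarkovChain P Z Q π →
        -- the independent random batch levels
        RandEG.IsIIDGeomHalf P J →
        IndepFun (fun ω n => Z n ω) (fun ω k => J k ω) P →
        -- the stochastic oracle
        ∀ (G : EuclideanSpace ℝ (Fin d) → S → EuclideanSpace ℝ (Fin d)) (σ Δ : ℝ),
        Measurable (Function.uncurry G) →
        (∀ x ∈ X, ∫ z, G x z ∂π = F x) →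
        (∀ x ∈ X, ∀ z, ‖G x z - F x‖ ^ 2 ≤ σ ^ 2 + Δ ^ 2 * ‖x - xstar‖ ^ 2) →
        -- the parameters of the method
        ∀ (x₀ : EuclideanSpace ℝ (Fin d)) (γ : ℝ) (B N : ℕ),
        x₀ ∈ X → 0 < γ → γ ≤ c / L → 1 ≤ B → 2 ≤ N →
        let xbar : Ω → EuclideanSpace ℝ (Fin d) := fun ω =>
          RandEG.averagedIterate G r X γ B (Real.sqrt N) x₀ (fun n => Z n ω) (fun k => J k ω) N
        (∀ ω, BddAbove (RandEG.gapSet F r X (xbar ω))) ∧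
        Integrable (fun ω => RandEG.gap F r X (xbar ω)) P ∧
        ∫ ω, RandEG.gap F r X (xbar ω) ∂P ≤
          C * (D ^ 2 / (γ * N) +
            γ * (τ / B * Real.logb 2 N + (τ : ℝ) ^ 2 / (B : ℝ) ^ 2) *
              (σ ^ 2 + Δ ^ 2 * D ^ 2)) := by
  -- `c = 1/2` is what absorbs the Lipschitz error in `extragradient_step_monotone_le`.
  refine ⟨1 / 2, 261, by norm_num, by norm_num, ?_⟩
  intro d S _ _ _ _ Ω _ P _ X F r xstar L D _ hXcl hXD hL hF hmono hc hr hstar Q _ π _ τ Z J hQ hZ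
    hJ hZJ G σ Δ hG hmean hnoise x₀ γ B N hx₀ hγ hγL hB hN
  have hX : IsCompact X := by
    refine Metric.isCompact_of_isClosed_isBounded hXcl (Metric.isBounded_iff.2 ⟨|D|, ?_⟩)
    intro x hx y hy
    rw [dist_eq_norm, ← abs_norm]
    exact sq_le_sq.1 (hXD x hx y hy)
  -- The solution lies in `X`, so `‖x - xstar‖² ≤ D²` makes the state-dependent noise bound uniform.
  have hs : ∀ x ∈ X, ∀ z, ‖G x z - RandEG.meanOp G π x‖ ≤ Real.sqrt (σ ^ 2 + Δ ^ 2 * D ^ 2) := by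
    intro x hx z
    refine Real.le_sqrt_of_sq_le ?_
    rw [RandEG.meanOp, hmean x hx]
    refine (hnoise x hx z).trans ?_
    have := hXD x hx xstar hstar.1
    gcongr
  obtain ⟨h1, h2⟩ := RandEG.integral_gap_averagedIterate_le hX hXD hL hF hmono hc hr hQ hZ hJ hZJ
    hG hmean hs hx₀ hγ hγL hB hN
  rw [Real.sq_sqrt (by positivity)] at h2
  exact ⟨fun ω => RandEG.bddAbove_gapSet hX hF hr _, h1, h2⟩
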